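/- Let $q$ be a prime power, let $n\ge 1$ satisfy $\gcd(q,n)=1$, put $K=\mathbb{F}_{q^2}$, and let $D_n=\langle a,b\mid a^n=b^2=1,\ bab=a^{-1}\rangle$ be the dihedral group of order $2n$. For $f=\sum_i a_i x^i\in K[x]$ put $\overline f=\sum_i a_i^q x^i$, and, if $f(0)\ne 0$, $f^*=f(0)^{-1}x^{\deg f}f(x^{-1})$ and $f^\dagger=\overline{f^*}$. Let $$x^n-1=\prod_{j\in J_0}f_j\prod_{j\in J_1}f_j\overline{f_j}\prod_{j\in J_2\cup J_3}f_jf_j^*\prod_{j\in J_4}f_jf_j^*\overline{f_j}f_j^\dagger$$ be a decomposition into monic irreducible polynomials of $K[x]$, where $j\in J_0$ iff $f_j=\overline{f_j}=f_j^*$ (so that $f_j\in\{x-1,x+1\}$); $j\in J_1$ iff $f_j=f_j^*\neq\overline{f_j}$; $j\in J_2$ iff $f_j=\overline{f_j}\ne f_j^*$; $j\in J_3$ iff $\overline{f_j}=f_j^*\neq f_j$; and $j\in J_4$ iff $f_j,\overline{f_j},f_j^*$ are pairwise different. Let $J=J_0\cup\dots\cup J_4$, $r_j=\deg f_j$, and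 let $\Omega$ be an extension field of $K$ that contains a root $\alpha_j$ of $f_j$ for every $j\in J$. For a positive integer $m$ define maps of $\mathcal M_2(\Omega)$ by $$\mathcal H^m\begin{bmatrix}x_1&x_2\\x_3&x_4\end{bmatrix}=\begin{bmatrix}x_1^{q^m}&x_2^{q^m}\\x_3^{q^m}&x_4^{q^m}\end{bmatrix},\qquad \mathcal T^m\begin{bmatrix}x_1&x_2\\x_3&x_4\end{bmatrix}=\begin{bmatrix}x_4^{q^m}&x_3^{q^m}\\x_2^{q^m}&x_1^{q^m}\end{bmatrix},$$ and, for $j\in J_1$, $\sigma_j(X)=Z_j^{-1}XZ_j$ and $\overline{\sigma_j}(X)=\overline{Z_j}^{-1}X\overline{Z_j}$, where $Z_j=\begin{bmatrix}1&-\alpha_j\\1&-\alpha_j^{-1}\end{bmatrix}$ and $\overline{Z_j}=\begin{bmatrix}1&-\alpha_j^{q}\\1&-\alpha_j^{-q}\end{bmatrix}$. Put $S=\begin{bmatrix}0&1\\1&0\end{bmatrix}$, $C_2=\langle S\rangle$ and $\Delta(\beta)=\begin{bmatrix}\beta&0\\0&\beta^{-1}\end{bmatrix}$, and let $$A_j=\begin{cases}K\oplus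 K&j\in J_0,\ \operatorname{char}K\ne2\\ K[C_2]\subseteq\mathcal M_2(K)&j\in J_0,\ \operatorname{char}K=2\\ \mathcal M_2(K(\alpha_j+\alpha_j^{-1}))\oplus\mathcal M_2(K(\alpha_j^q+\alpha_j^{-q}))&j\in J_1\\ \mathcal M_2(K(\alpha_j))&j\in J_2\cup J_3\\ \mathcal M_2(K(\alpha_j))\oplus\mathcal M_2(K(\alpha_j^q))&j\in J_4.\end{cases}$$ Then there is an isomorphism of $K$-algebras $\rho=\bigoplus_{j\in J}\rho_j:K[D_n]\to\bigoplus_{j\in J}A_j$ whose values on the generators are as follows. If $j\in J_0$ and $\operatorname{char}K\neq2$: $\rho_j(a)=(1,1)$ if $f_j=x-1$ and $\rho_j(a)=(-1,-1)$ if $f_j=x+1$, and $\rho_j(b)=(1,-1)$. If $j\in J_0$ and $\operatorname{char}K=2$: $\rho_j(a)=I$ and $\rho_j(b)=S$. If $j\in J_1$: $\rho_j(a)=\sigma_j(\Delta(\alpha_j))\oplus\overline{\sigma_j}(\Delta(\alpha_j^q))$ and $\rho_j(b)=\sigma_j(S)\oplus\overline{\sigma_j}(S)$. If $j\in J_2\cup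 J_3$: $\rho_j(a)=\Delta(\alpha_j)$ and $\rho_j(b)=S$. If $j\in J_4$: $\rho_j(a)=\Delta(\alpha_j)\oplus\Delta(\alpha_j^q)$ and $\rho_j(b)=S\oplus S$. Moreover, the formulas $$\begin{cases}\varphi_j(x\oplus y)=x^q\oplus y^q&j\in J_0,\ \operatorname{char}K\neq2\\ \varphi_j(X)=\mathcal H^1(X)&j\in J_0,\ \operatorname{char}K=2\\ \varphi_j(X\oplus Y)=(\sigma_j\circ\mathcal H^{2r_j-1}\circ\overline{\sigma_j}^{\,-1})(Y)\oplus(\overline{\sigma_j}\circ\mathcal H^1\circ\sigma_j^{-1})(X)&j\in J_1\\ \varphi_j(X)=\mathcal H^{r_j}(X)&j\in J_2\\ \varphi_j(X)=\mathcal T^{r_j}(X)&j\in J_3\\ \varphi_j(X\oplus Y)=\mathcal H^{2r_j-1}(Y)\oplus\mathcal H^1(X)&j\in J_4\end{cases}$$ define maps $\varphi_j:A_j\to A_j$, and with $\varphi=\bigoplus_{j\in J}\varphi_j$ and $\operatorname{conj}_q\bigl(\sum_g c_g g\bigr)=\sum_g c_g^q g$ one has $$\rho(\operatorname{conj}_q(u))=\varphi(\rho(u))\qquad\text{for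 all }u\in K[D_n].$$ -/

import Mathlib

open Polynomial
open scoped IntermediateField

namespace DihedralConj

noncomputable section

/-! ### Polynomials over `K = 𝔽_{q²}` -/

/-- The conjugate polynomial: every coefficient is raised to the `q`-th power. -/
def conjPoly {K : Type*} [Field K] (q : ℕ) (f : K[X]) : K[X] :=
  f.sum fun i c => monomial i (c ^ q)

/-- The reciprocal polynomial `f(0)⁻¹ X ^ deg f f(X⁻¹)`. -/
def recipPoly {K : Type*} [Field K] (f : K[X]) : K[X] :=
  C (f.coeff 0)⁻¹ * f.reverse

/-- The types of blocks. `J0odd` and `J0two` are the blocks with index in `J₀`, in characteristic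
different from two and equal to two respectively. -/
inductive Kind where
  | J0odd : Kind
  | J0two : Kind
  | J1 : Kind
  | J2 : Kind
  | J3 : Kind
  | J4 : Kind

open Classical in
/-- The index set `J₀, …, J₄` to which (the index of) `f` belongs. -/
def kind {K : Type*} [Field K] (q : ℕ) (f : K[X]) : Kind :=
  if f = conjPoly q f ∧ f = recipPoly f then
    if ringChar K = 2 then .J0two else .J0odd
  else if f = recipPoly f then .J1
  else if f = conjPoly q f then .J2
  else if conjPoly q f = recipPoly f then .J3
  else .J4

/-- The factor that `f` contributes to `X ^ n - 1`: the product of the distinct polynomials among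
`f`, its reciprocal, its conjugate, and the conjugate of its reciprocal. -/
def orbitProd {K : Type*} [Field K] (q : ℕ) (f : K[X]) : K[X] :=
  match kind q f with
  | .J0odd => f
  | .J0two => f
  | .J1 => f * conjPoly q f
  | .J2 => f * recipPoly f
  | .J3 => f * recipPoly f
  | .J4 => f * recipPoly f * conjPoly q f * conjPoly q (recipPoly f)

/-- The decomposition of `X ^ n - 1` into monic irreducible factors, grouped by means of
conjugation and reciprocity; `f j` is the chosen representative of the group with index `j`. -/
structure IsDecomposition {K : Type*} [Field K] (q n : ℕ) {J : Type*} [Fintype J]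
    (f : J → K[X]) : Prop where
  monic : ∀ j, (f j).Monic
  irreducible : ∀ j, Irreducible (f j)
  prod_eq : (X : K[X]) ^ n - 1 = ∏ j, orbitProd q (f j)

/-! ### The group algebra -/

/-- The map `∑ c_g g ↦ ∑ c_g ^ q g`. -/
def conjAlg {K G : Type*} [Field K] (q : ℕ) (u : MonoidAlgebra K G) : MonoidAlgebra K G :=
  u.coeff.sum fun g c => MonoidAlgebra.single g (c ^ q)

/-! ### Maps of two by two matrices -/

/-- Two by two matrices. -/
abbrev M2 (R : Type*) := Matrix (Fin 2) (Fin 2) R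

/-- The matrix `Z` attached to `α`. The matrix `Z̄` is the one attached to `α ^ q`. -/
def Zmat {Ω : Type*} [Field Ω] (α : Ω) : M2 Ω := !![1, -α; 1, -α⁻¹]

/-- Conjugation by `Z`. The map `σ̄` is `sigma (α ^ q)`. -/
def sigma {Ω : Type*} [Field Ω] (α : Ω) (X : M2 Ω) : M2 Ω := (Zmat α)⁻¹ * X * Zmat α

/-- The inverse map of `sigma α`. -/
def sigmaInv {Ω : Type*} [Field Ω] (α : Ω) (X : M2 Ω) : M2 Ω := Zmat α * X * (Zmat α)⁻¹

theorem isUnit_det_Zmat {Ω : Type*} [Field Ω] {α : Ω} (h : α ≠ α⁻¹) :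
    IsUnit (Zmat α).det := by
  have : (Zmat α).det = α - α⁻¹ := by
    simp [Zmat, Matrix.det_fin_two]
    ring
  rw [this]
  exact (sub_ne_zero.mpr h).isUnit

theorem sigmaInv_sigma {Ω : Type*} [Field Ω] {α : Ω} (h : α ≠ α⁻¹) :
    Function.LeftInverse (sigmaInv α) (sigma α) ∧
      Function.RightInverse (sigmaInv α) (sigma α) := by
  have hu := isUnit_det_Zmat h
  constructor
  · intro X
    simp only [sigma, sigmaInv]
    rw [← Matrix.mul_assoc, ← Matrix.mul_assoc, Matrix.mul_nonsing_inv _ hu, Matrix.one_mul,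
      Matrix.mul_assoc, Matrix.mul_nonsing_inv _ hu, Matrix.mul_one]
  · intro X
    simp only [sigma, sigmaInv]
    rw [← Matrix.mul_assoc, ← Matrix.mul_assoc, Matrix.nonsing_inv_mul _ hu, Matrix.one_mul,
      Matrix.mul_assoc, Matrix.nonsing_inv_mul _ hu, Matrix.mul_one]

/-- The map `H ^ m`: every entry is raised to the power `q ^ m`. -/
def Hmap {Ω : Type*} [Field Ω] (q m : ℕ) (X : M2 Ω) : M2 Ω :=
  !![X 0 0 ^ q ^ m, X 0 1 ^ q ^ m; X 1 0 ^ q ^ m, X 1 1 ^ q ^ m]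

/-- The map `T ^ m`. -/
def Tmap {Ω : Type*} [Field Ω] (q m : ℕ) (X : M2 Ω) : M2 Ω :=
  !![X 1 1 ^ q ^ m, X 1 0 ^ q ^ m; X 0 1 ^ q ^ m, X 0 0 ^ q ^ m]

/-- The diagonal matrix with entries `α` and `α⁻¹`. -/
def diagMat {Ω : Type*} [Field Ω] (α : Ω) : M2 Ω := !![α, 0; 0, α⁻¹]

/-- The matrix that swaps the two coordinates. -/
def swapMat {Ω : Type*} [Field Ω] : M2 Ω := !![0, 1; 1, 0]

/-! ### The blocks -/

/-- An algebra over the field `Ω` in which the block of the given kind lives. -/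
def Amb (Ω : Type*) : Kind → Type _
  | .J0odd => Ω × Ω
  | .J0two => M2 Ω
  | .J1 => M2 Ω × M2 Ω
  | .J2 => M2 Ω
  | .J3 => M2 Ω
  | .J4 => M2 Ω × M2 Ω

instance Amb.instRing (Ω : Type*) [Field Ω] : (k : Kind) → Ring (Amb Ω k)
  | .J0odd => inferInstanceAs (Ring (Ω × Ω))
  | .J0two => inferInstanceAs (Ring (M2 Ω))
  | .J1 => inferInstanceAs (Ring (M2 Ω × M2 Ω))
  | .J2 => inferInstanceAs (Ring (M2 Ω))
  | .J3 => inferInstanceAs (Ring (M2 Ω))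
  | .J4 => inferInstanceAs (Ring (M2 Ω × M2 Ω))

instance Amb.instAlgebra (K Ω : Type*) [Field K] [Field Ω] [Algebra K Ω] :
    (k : Kind) → Algebra K (Amb Ω k)
  | .J0odd => inferInstanceAs (Algebra K (Ω × Ω))
  | .J0two => inferInstanceAs (Algebra K (M2 Ω))
  | .J1 => inferInstanceAs (Algebra K (M2 Ω × M2 Ω))
  | .J2 => inferInstanceAs (Algebra K (M2 Ω))
  | .J3 => inferInstanceAs (Algebra K (M2 Ω))
  | .J4 => inferInstanceAs (Algebra K (M2 Ω × M2 Ω))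

/-- The algebra `M₂(L)` inside `M₂(Ω)`, for an intermediate field `L`. -/
def matOver {K Ω : Type*} [Field K] [Field Ω] [Algebra K Ω] (L : IntermediateField K Ω) :
    Subalgebra K (M2 Ω) :=
  (L.val.mapMatrix : M2 L →ₐ[K] M2 Ω).range

/-- The block `A_j`: `K ⊕ K`, `K[C₂]` with `C₂` generated by the swap matrix,
`M₂(K(α + α⁻¹)) ⊕ M₂(K(α ^ q + α ^ (-q)))`, `M₂(K(α))` (twice), `M₂(K(α)) ⊕ M₂(K(α ^ q))`,
as a subalgebra of the algebra over `Ω` above. -/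
def block (K : Type*) {Ω : Type*} [Field K] [Field Ω] [Algebra K Ω] (q : ℕ) (α : Ω) :
    (k : Kind) → Subalgebra K (Amb Ω k)
  | .J0odd => ((⊥ : Subalgebra K Ω).prod ⊥ : Subalgebra K (Ω × Ω))
  | .J0two => (Algebra.adjoin K {swapMat} : Subalgebra K (M2 Ω))
  | .J1 => ((matOver K⟮α + α⁻¹⟯).prod (matOver K⟮α ^ q + (α ^ q)⁻¹⟯) :
      Subalgebra K (M2 Ω × M2 Ω))
  | .J2 => (matOver K⟮α⟯ : Subalgebra K (M2 Ω))
  | .J3 => (matOver K⟮α⟯ : Subalgebra K (M2 Ω))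
  | .J4 => ((matOver K⟮α⟯).prod (matOver K⟮α ^ q⟯) : Subalgebra K (M2 Ω × M2 Ω))

open Classical in
/-- The image of the rotation `a` in the block attached to `f` and to the root `α`. -/
def rhoA {K Ω : Type*} [Field K] [Field Ω] (q : ℕ) (f : K[X]) (α : Ω) : (k : Kind) → Amb Ω k
  | .J0odd => (if f = X - 1 then ((1, 1) : Ω × Ω) else ((-1, -1) : Ω × Ω))
  | .J0two => (1 : M2 Ω)
  | .J1 => ((sigma α (diagMat α), sigma (α ^ q) (diagMat (α ^ q))) : M2 Ω × M2 Ω)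
  | .J2 => (diagMat α : M2 Ω)
  | .J3 => (diagMat α : M2 Ω)
  | .J4 => ((diagMat α, diagMat (α ^ q)) : M2 Ω × M2 Ω)

/-- The image of the reflection `b` in the block attached to the root `α`. -/
def rhoB {Ω : Type*} [Field Ω] (q : ℕ) (α : Ω) : (k : Kind) → Amb Ω k
  | .J0odd => ((1, -1) : Ω × Ω)
  | .J0two => (swapMat : M2 Ω)
  | .J1 => ((sigma α swapMat, sigma (α ^ q) swapMat) : M2 Ω × M2 Ω)
  | .J2 => (swapMat : M2 Ω)
  | .J3 => (swapMat : M2 Ω)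
  | .J4 => ((swapMat, swapMat) : M2 Ω × M2 Ω)

/-- The formula for the map `φ_j`, where `r` is the degree of `f_j` and `α` its chosen root. -/
def phi {Ω : Type*} [Field Ω] (q r : ℕ) (α : Ω) : (k : Kind) → Amb Ω k → Amb Ω k
  | .J0odd => fun x : Ω × Ω => ((x.1 ^ q, x.2 ^ q) : Ω × Ω)
  | .J0two => fun X : M2 Ω => (Hmap q 1 X : M2 Ω)
  | .J1 => fun X : M2 Ω × M2 Ω =>
      ((sigma α (Hmap q (2 * r - 1) (sigmaInv (α ^ q) X.2)),
        sigma (α ^ q) (Hmap q 1 (sigmaInv α X.1))) : M2 Ω × M2 Ω)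
  | .J2 => fun X : M2 Ω => (Hmap q r X : M2 Ω)
  | .J3 => fun X : M2 Ω => (Tmap q r X : M2 Ω)
  | .J4 => fun X : M2 Ω × M2 Ω => ((Hmap q (2 * r - 1) X.2, Hmap q 1 X.1) : M2 Ω × M2 Ω)

end

end DihedralConj

/-! An element of `K[D_n]` is uniquely `P(a) + b Q(a)` with `deg P, deg Q < n`. In each block the
prescribed matrices `A` and `b` satisfy the dihedral relations, so they define a representation
sending this element to `P(A) + b Q(A)`. After undoing `σ` where it occurs, `A` is diagonal with
entries `α` and `α⁻¹` (and likewise for `α ^ q`), so the vanishing of the image forces `P` and `Q`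
to vanish at a root of every irreducible factor of the orbit product. Since `n ≠ 0` in `K`, the
product `X ^ n - 1` of all orbit products is squarefree; it then divides `P` and `Q`, which must be
zero. Thus `ρ` is injective. Only an upper bound, twice the degree of the orbit product, is needed
for the dimension of each block: these bounds sum to `2n = dim K[D_n]`, so `ρ` is bijective.

For conjugation it suffices that each `φ_j` is a ring endomorphism of the ambient algebra that acts
on scalars as `c ↦ c ^ q` and fixes the images of `a` and `b`. This comes down to Frobenius orbits:
with `r = deg f`, `α ^ q ^ r` is `α` for `J₂` and `α⁻¹` for `J₃`, both with `r` odd, while `α ^ q ^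
(2r) = α` always. That `φ_j` preserves the block then follows from the surjectivity of `ρ_j`.

The main lemmas are `isBlockRep_block`, `IsBlockRep.exists_algHom`, `exists_eq_pow` and
`finrank_adjoin_add_inv`. -/

namespace DihedralConj

noncomputable section

/-! ### Conjugate and reciprocal polynomials -/

/-- `q` is a power of the characteristic of `R`, which is a prime number. -/
def IsCharPow (R : Type*) [Ring R] (q : ℕ) : Prop :=
  ∃ p e : ℕ, p.Prime ∧ CharP R p ∧ q = p ^ e

/-- The ring endomorphism `x ↦ x ^ q ^ m`. -/
def powHom {R : Type*} [CommRing R] {q : ℕ} (h : IsCharPow R q) (m : ℕ) : R →+* R where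
  toFun x := x ^ q ^ m
  map_one' := one_pow _
  map_mul' x y := mul_pow x y _
  map_zero' := by
    obtain ⟨p, e, hp, -, rfl⟩ := h
    exact zero_pow (by have := hp.pos; positivity)
  map_add' x y := by
    obtain ⟨p, e, hp, hc, rfl⟩ := h
    have := Fact.mk hp
    simp only [← pow_mul]
    exact add_pow_char_pow x y p _

@[simp]
theorem powHom_apply {R : Type*} [CommRing R] {q : ℕ} (h : IsCharPow R q) (m : ℕ) (x : R) :
    powHom h m x = x ^ q ^ m := rfl

/-- That `q` is a prime power is automatic: it divides `q ^ 2`, the order of a finite field. -/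
theorem isCharPow_of_card {K : Type*} [Field K] [Finite K] {q : ℕ} (hK : Nat.card K = q ^ 2) :
    IsCharPow K q := by
  obtain ⟨p, hc⟩ := CharP.exists K
  have : Fintype K := Fintype.ofFinite K
  obtain ⟨k, hp, hk⟩ := FiniteField.card K p
  have h1 : q ^ 2 = p ^ (k : ℕ) := by rw [← hK, Nat.card_eq_fintype_card, hk]
  obtain ⟨e, -, he⟩ := (Nat.dvd_prime_pow hp).1 (h1 ▸ dvd_pow_self q two_ne_zero)
  exact ⟨p, e, hp, hc, he⟩

theorem IsCharPow.of_algebra {K : Type*} (Ω : Type*) [Field K] [Field Ω] [Algebra K Ω] {q : ℕ}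
    (h : IsCharPow K q) : IsCharPow Ω q := by
  obtain ⟨p, e, hp, hc, he⟩ := h
  exact ⟨p, e, hp, charP_of_injective_algebraMap (algebraMap K Ω).injective p, he⟩

theorem IsCharPow.pow_injective {R : Type*} [Field R] {q : ℕ} (h : IsCharPow R q) (m : ℕ) :
    Function.Injective fun x : R => x ^ q ^ m :=
  (powHom h m).injective

theorem conjPoly_eq_map {K : Type*} [Field K] {q : ℕ} (h : IsCharPow K q) (f : K[X]) :
    conjPoly q f = f.map (powHom h 1) := by
  ext i
  simp only [conjPoly, Polynomial.sum_def, finsetSum_coeff, coeff_monomial, coeff_map,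
    powHom_apply, pow_one, Finset.sum_ite_eq', mem_support_iff]
  split_ifs with h0
  · rfl
  · have := map_zero (powHom h 1)
    rw [powHom_apply, pow_one] at this
    rw [notMem_support_iff.1 h0, this]

theorem conjPoly_irreducible {K : Type*} [Field K] [Finite K] {q : ℕ} (h : IsCharPow K q)
    {f : K[X]} (hf : Irreducible f) : Irreducible (conjPoly q f) := by
  rw [conjPoly_eq_map h]
  have hb : Function.Bijective (powHom h 1) :=
    Finite.injective_iff_bijective.1 (powHom h 1).injective
  exact (MulEquiv.irreducible_iff (mapEquiv (RingEquiv.ofBijective _ hb))).2 hf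

theorem natDegree_conjPoly {K : Type*} [Field K] {q : ℕ} (h : IsCharPow K q) (f : K[X]) :
    (conjPoly q f).natDegree = f.natDegree := by
  rw [conjPoly_eq_map h, natDegree_map]

theorem aeval_conjPoly {K Ω : Type*} [Field K] [Field Ω] [Algebra K Ω] {q : ℕ}
    (h : IsCharPow K q) (f : K[X]) (α : Ω) : aeval (α ^ q) (conjPoly q f) = aeval α f ^ q := by
  have h' := h.of_algebra Ω
  have h1 := hom_eval₂ f (algebraMap K Ω) (powHom h' 1) α
  rw [powHom_apply, powHom_apply, pow_one] at h1
  rw [conjPoly_eq_map h, aeval_def, aeval_def, h1, eval₂_map]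
  congr 1
  ext x
  simp

/-- With nonzero constant term the reverse equals the mirror, which is multiplicative and
involutive, so factorizations of one polynomial mirror to factorizations of the other. -/
theorem recipPoly_irreducible {K : Type*} [Field K] {f : K[X]} (hf : Irreducible f)
    (h0 : f.coeff 0 ≠ 0) : Irreducible (recipPoly f) := by
  have hm : f.reverse = f.mirror := by
    rw [mirror, natTrailingDegree_eq_zero.2 (Or.inr h0), pow_zero, mul_one]
  have hu : IsUnit (C (f.coeff 0)⁻¹) := isUnit_C.2 (inv_ne_zero h0).isUnit
  rw [recipPoly, irreducible_isUnit_mul hu, hm]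
  have key : ∀ a : K[X], IsUnit a.mirror → IsUnit a := by
    intro a ha
    have h1 : a ≠ 0 := fun h => ha.ne_zero (mirror_eq_zero.2 h)
    rw [isUnit_iff_degree_eq_zero, degree_eq_natDegree h1, ← mirror_natDegree,
      natDegree_eq_zero_of_isUnit ha, Nat.cast_zero]
  refine ⟨fun h => hf.not_isUnit ?_, fun a b hab => ?_⟩
  · exact key _ h
  · have : f = a.mirror * b.mirror := by
      rw [← mirror_mul_of_domain, ← hab, mirror_mirror]
    exact (hf.isUnit_or_isUnit this).imp (key _) (key _)

theorem natDegree_recipPoly {K : Type*} [Field K] {f : K[X]}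
    (h0 : f.coeff 0 ≠ 0) : (recipPoly f).natDegree = f.natDegree := by
  rw [recipPoly, natDegree_C_mul (inv_ne_zero h0), reverse_natDegree,
    natTrailingDegree_eq_zero.2 (Or.inr h0), Nat.sub_zero]

theorem aeval_recipPoly {K Ω : Type*} [Field K] [Field Ω] [Algebra K Ω] {f : K[X]} {α : Ω}
    (hα : α ≠ 0) (h : aeval α f = 0) : aeval α⁻¹ (recipPoly f) = 0 := by
  let _ := invertibleOfNonzero hα
  have := (eval₂_reverse_eq_zero_iff (algebraMap K Ω) α f).2 h
  rw [invOf_eq_inv] at this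
  rw [recipPoly, map_mul, aeval_def α⁻¹ f.reverse, this, mul_zero]

theorem dvd_of_common_root {K Ω : Type*} [Field K] [Field Ω] [Algebra K Ω] {f g : K[X]} {α : Ω}
    (hf : Irreducible f) (h : aeval α f = 0) (hg : aeval α g = 0) : f ∣ g := by
  by_contra hd
  obtain ⟨a, b, hab⟩ := (hf.coprime_iff_not_dvd).2 hd
  have := congrArg (aeval α) hab
  simp [h, hg] at this

/-! ### Frobenius orbits of roots -/

section FiniteField

variable {K Ω : Type*} [Field K] [Finite K] [Field Ω] [Algebra K Ω] {q : ℕ}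

/-- The irreducible polynomials of degree dividing `m` are exactly the irreducible divisors of `X ^
(q ^ 2) ^ m - X`. -/
theorem natDegree_dvd_iff_pow_eq (hK : Nat.card K = q ^ 2) {f : K[X]} (hf : Irreducible f) {α : Ω}
    (h : aeval α f = 0) (m : ℕ) : f.natDegree ∣ m ↔ α ^ q ^ (2 * m) = α := by
  rw [hf.natDegree_dvd_iff_dvd_X_pow_card_pow_sub_X, hK, ← pow_mul]
  constructor
  · rintro ⟨g, hg⟩
    have := congrArg (aeval α) hg
    simpa [h, sub_eq_zero] using this
  · intro h1
    exact dvd_of_common_root hf h (by simp [h1])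

/-- `K(α)` is normal over `K`, so the embedding `α ↦ β` is an automorphism of it, and every
automorphism is a power of the Frobenius `x ↦ x ^ q ^ 2`. -/
theorem exists_eq_pow (hK : Nat.card K = q ^ 2) {f : K[X]} (hf : Irreducible f) {α β : Ω}
    (h : aeval α f = 0) (hβ : aeval β f = 0) : ∃ i : ℕ, β = α ^ q ^ (2 * i) := by
  have hi : IsIntegral K α := isAlgebraic_iff_isIntegral.1 ⟨f, hf.ne_zero, h⟩
  have : FiniteDimensional K K⟮α⟯ := IntermediateField.adjoin.finiteDimensional hi
  have : Finite K⟮α⟯ := Module.finite_of_finite K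
  have hm : aeval β (minpoly K α) = 0 := by
    obtain ⟨g, hg⟩ := dvd_of_common_root hf h (minpoly.aeval K α)
    rw [hg, map_mul, hβ, zero_mul]
  let φ : K⟮α⟯ →ₐ[K] Ω := (IntermediateField.algHomAdjoinIntegralEquiv K hi).symm
    ⟨β, by rw [mem_aroots]; exact ⟨minpoly.ne_zero hi, hm⟩⟩
  have hφ : φ (IntermediateField.AdjoinSimple.gen K α) = β :=
    IntermediateField.algHomAdjoinIntegralEquiv_symm_apply_gen K hi _
  have hr : φ.fieldRange = K⟮α⟯ := AlgHom.fieldRange_of_normal φ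
  have hmem : ∀ x, φ x ∈ K⟮α⟯.toSubalgebra := fun x => by
    have : φ x ∈ φ.fieldRange := ⟨x, rfl⟩
    rwa [hr] at this
  have : Fintype K := Fintype.ofFinite K
  obtain ⟨i, hi'⟩ := (FiniteField.bijective_frobeniusAlgHom_pow K K⟮α⟯).2
    (φ.codRestrict K⟮α⟯.toSubalgebra hmem)
  refine ⟨i, ?_⟩
  have := congrArg Subtype.val (DFunLike.congr_fun hi' (IntermediateField.AdjoinSimple.gen K α))
  simp only [AlgHom.coe_pow, FiniteField.coe_frobeniusAlgHom, pow_iterate] at this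
  rw [← hφ, pow_mul, ← hK, Nat.card_eq_fintype_card]
  exact this.symm

end FiniteField

theorem eq_X_sub_C_of_root {K Ω : Type*} [Field K] [Field Ω] [Algebra K Ω] {f : K[X]}
    (hm : f.Monic) (hf : Irreducible f) {a : K} (h : aeval (algebraMap K Ω a) f = 0) :
    f = X - C a :=
  eq_of_monic_of_associated hm (monic_X_sub_C a)
    (hf.associated_of_dvd (irreducible_X_sub_C a) (dvd_of_common_root hf h (by simp)))

theorem conjPoly_X_sub_C {K : Type*} [Field K] {q : ℕ} (h : IsCharPow K q) {a : K}
    (ha : powHom h 1 a = a) : conjPoly q (X - C a) = X - C a := by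
  rw [conjPoly_eq_map h, Polynomial.map_sub, map_X, map_C, ha]

theorem pow_pow_add {Ω : Type*} [Monoid Ω] (α : Ω) (q a b : ℕ) :
    α ^ q ^ (a + b) = (α ^ q ^ a) ^ q ^ b := by
  rw [pow_add, pow_mul]

theorem eq_one_or_of_eq_inv {Ω : Type*} [Field Ω] {α : Ω} (h0 : α ≠ 0) (h : α = α⁻¹) :
    α = 1 ∨ α = -1 := by
  rw [← sq_eq_one_iff, sq]
  nth_rw 2 [h]
  exact mul_inv_cancel₀ h0

theorem finrank_adjoin_root {K Ω : Type*} [Field K] [Field Ω] [Algebra K Ω]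
    {f : K[X]} (hm : f.Monic) (hf : Irreducible f) {α : Ω} (h : aeval α f = 0) :
    FiniteDimensional K K⟮α⟯ ∧ Module.finrank K K⟮α⟯ = f.natDegree := by
  have hi : IsIntegral K α := ⟨f, hm, h⟩
  refine ⟨IntermediateField.adjoin.finiteDimensional hi, ?_⟩
  rw [IntermediateField.adjoin.finrank hi, minpoly.eq_of_irreducible_of_monic hf h hm]

/-! ### Roots of self-conjugate and self-reciprocal factors -/

section FiniteField

variable {K Ω : Type*} [Field K] [Finite K] [Field Ω] [Algebra K Ω] {q : ℕ}

/-- The hypothesis gives `r ∣ k` for `r = deg f`, so `r` and `k / r` are odd. Hence `k` is `r` plus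
a multiple of `2r`, and `q ^ (2r)`-th powers fix `α`. -/
theorem pow_eq_of_odd_of_dvd (hK : Nat.card K = q ^ 2) {f : K[X]} (hf : Irreducible f) {α : Ω}
    (h : aeval α f = 0) {k : ℕ} (hk : Odd k) (hd : α ^ q ^ (2 * k) = α) :
    Odd f.natDegree ∧ α ^ q ^ k = α ^ q ^ f.natDegree := by
  obtain ⟨t, rfl⟩ := (natDegree_dvd_iff_pow_eq hK hf h k).2 hd
  obtain ⟨h1, s, rfl⟩ := Nat.odd_mul.1 hk
  refine ⟨h1, ?_⟩
  rw [show f.natDegree * (2 * s + 1) = 2 * (f.natDegree * s) + f.natDegree by ring, pow_pow_add,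
    (natDegree_dvd_iff_pow_eq hK hf h _).1 (dvd_mul_right _ s)]

/-- Both `α` and `α ^ q` are roots of `f`, hence lie in one Frobenius orbit; this yields an odd `k`
with `α ^ q ^ k = α`. -/
theorem odd_natDegree_of_eq_conjPoly (hK : Nat.card K = q ^ 2) {f : K[X]} (hf : Irreducible f)
    {α : Ω} (h : aeval α f = 0) (hc : f = conjPoly q f) :
    Odd f.natDegree ∧ α ^ q ^ f.natDegree = α := by
  have hq := isCharPow_of_card hK
  have h1 : aeval (α ^ q) f = 0 := by
    conv_lhs => rw [hc]
    rw [aeval_conjPoly hq, h, ← pow_one q]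
    exact map_zero (powHom (hq.of_algebra Ω) 1)
  obtain ⟨i, hi⟩ := exists_eq_pow hK hf h1 h
  have hi' : α ^ q ^ (1 + 2 * i) = α := by rw [pow_pow_add, pow_one, ← hi]
  obtain ⟨h2, h3⟩ := pow_eq_of_odd_of_dvd hK hf h (k := 1 + 2 * i)
    (odd_one.add_even (even_two_mul i))
    (by rw [two_mul, pow_pow_add, hi', hi'])
  exact ⟨h2, h3 ▸ hi'⟩

/-- Here `α ^ q` and `α⁻¹` are roots of the same irreducible polynomial, so `α ^ q ^ k = α⁻¹` for
some odd `k`; applying this twice gives `α ^ q ^ (2k) = α`. -/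
theorem odd_natDegree_of_conjPoly_eq_recipPoly (hK : Nat.card K = q ^ 2) {f : K[X]}
    (hf : Irreducible f) {α : Ω} (h0 : α ≠ 0) (h : aeval α f = 0)
    (hc : conjPoly q f = recipPoly f) :
    Odd f.natDegree ∧ α ^ q ^ f.natDegree = α⁻¹ := by
  have hq := isCharPow_of_card hK
  have h1 : aeval (α ^ q) (conjPoly q f) = 0 := by
    rw [aeval_conjPoly hq, h, ← pow_one q]
    exact map_zero (powHom (hq.of_algebra Ω) 1)
  obtain ⟨i, hi⟩ := exists_eq_pow hK (conjPoly_irreducible hq hf) h1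
    (hc ▸ aeval_recipPoly h0 h : aeval α⁻¹ (conjPoly q f) = 0)
  have hi' : α ^ q ^ (1 + 2 * i) = α⁻¹ := by rw [pow_pow_add, pow_one, ← hi]
  obtain ⟨h2, h3⟩ := pow_eq_of_odd_of_dvd hK hf h (k := 1 + 2 * i)
    (odd_one.add_even (even_two_mul i))
    (by rw [two_mul, pow_pow_add, hi', inv_pow, hi', inv_inv])
  exact ⟨h2, h3 ▸ hi'⟩

/-- If `α⁻¹ = α ^ q ^ (2i)`, applying this power twice returns `α`, so `deg f ∣ 2i`. The degree is
odd by self-conjugacy, so it divides `i`, and the power already fixes `α`. -/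
theorem eq_inv_of_self_conj_of_self_recip (hK : Nat.card K = q ^ 2) {f : K[X]}
    (hf : Irreducible f) {α : Ω} (h0 : α ≠ 0) (h : aeval α f = 0) (hc : f = conjPoly q f)
    (hr : f = recipPoly f) : α = α⁻¹ := by
  obtain ⟨i, hi⟩ := exists_eq_pow hK hf h (hr ▸ aeval_recipPoly h0 h : aeval α⁻¹ f = 0)
  have h2 := (natDegree_dvd_iff_pow_eq hK hf h (2 * i)).2
    (by rw [two_mul (2 * i), pow_pow_add, ← hi, inv_pow, ← hi, inv_inv])
  have h3 := ((odd_natDegree_of_eq_conjPoly hK hf h hc).1.coprime_two_right).dvd_of_dvd_mul_left h2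
  rw [hi, (natDegree_dvd_iff_pow_eq hK hf h i).1 h3]

/-- Used contrapositively: on `J₁` it gives `α ≠ α⁻¹`, which makes `Z` invertible. -/
theorem eq_conjPoly_of_eq_inv (hK : Nat.card K = q ^ 2) {f : K[X]} (hm : f.Monic)
    (hf : Irreducible f) {α : Ω} (h0 : α ≠ 0) (h : aeval α f = 0) (he : α = α⁻¹) :
    f = conjPoly q f := by
  have hq := isCharPow_of_card hK
  rcases eq_one_or_of_eq_inv h0 he with rfl | rfl
  · rw [eq_X_sub_C_of_root hm hf (Ω := Ω) (a := 1) (by rwa [map_one]),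
      conjPoly_X_sub_C hq (map_one _)]
  · rw [eq_X_sub_C_of_root hm hf (Ω := Ω) (a := -1) (by rwa [map_neg, map_one]),
      conjPoly_X_sub_C hq (by rw [map_neg, map_one])]

/-- Some power of the Frobenius exchanges `α` and `α⁻¹`. It fixes `K(α + α⁻¹)` pointwise but moves
`α`, so this subfield is proper in `K(α)` and the relative degree is at least two. -/
theorem finrank_adjoin_add_inv (hK : Nat.card K = q ^ 2) {f : K[X]} (hm : f.Monic)
    (hf : Irreducible f) {α : Ω} (h : aeval α f = 0) (h' : aeval α⁻¹ f = 0) (hne : α ≠ α⁻¹) :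
    FiniteDimensional K K⟮α + α⁻¹⟯ ∧ 2 * Module.finrank K K⟮α + α⁻¹⟯ ≤ f.natDegree := by
  obtain ⟨hfd, hr⟩ := finrank_adjoin_root hm hf h
  have hq := (isCharPow_of_card hK).of_algebra Ω
  obtain ⟨i, hi⟩ := exists_eq_pow hK hf h h'
  have hle : K⟮α + α⁻¹⟯ ≤ K⟮α⟯ := by
    have := IntermediateField.mem_adjoin_simple_self K α
    rw [IntermediateField.adjoin_simple_le_iff]
    exact add_mem this (inv_mem this)
  have hfix : ∀ x ∈ K⟮α + α⁻¹⟯, powHom hq (2 * i) x = x := by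
    intro x hx
    induction hx using IntermediateField.adjoin_induction with
    | mem x hx =>
      rw [Set.mem_singleton_iff.1 hx, map_add, map_inv₀, powHom_apply, ← hi, inv_inv, add_comm]
    | algebraMap c =>
      have : Fintype K := Fintype.ofFinite K
      rw [powHom_apply, ← map_pow, pow_mul, ← hK, Nat.card_eq_fintype_card,
        FiniteField.pow_card_pow]
    | add x y _ _ hx hy => rw [map_add, hx, hy]
    | inv x _ hx => rw [map_inv₀, hx]
    | mul x y _ _ hx hy => rw [map_mul, hx, hy]
  have hlt : K⟮α + α⁻¹⟯ ≠ K⟮α⟯ := fun he => hne <| by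
    rw [hi]
    exact (hfix α (he ▸ IntermediateField.mem_adjoin_simple_self K α)).symm
  have hfd' : FiniteDimensional K K⟮α + α⁻¹⟯ :=
    IntermediateField.adjoin.finiteDimensional
      (IsIntegral.add ⟨f, hm, h⟩ ⟨f, hm, h'⟩)
  refine ⟨hfd', ?_⟩
  obtain ⟨t, ht⟩ := IntermediateField.finrank_dvd_of_le_right hle
  have hpos : 0 < f.natDegree := hf.natDegree_pos
  rw [← hr] at hpos ⊢
  rw [ht] at hpos ⊢
  have ht1 : t ≠ 1 := by
    rintro rfl
    exact hlt (IntermediateField.eq_of_le_of_finrank_eq hle (by rw [ht, mul_one]))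
  have ht0 : t ≠ 0 := by
    rintro rfl
    simp at hpos
  rw [mul_comm]
  exact Nat.mul_le_mul_left _ (by lia)

end FiniteField

/-! ### Diagonal and swap matrices, and conjugation by `Z` -/

section Matrices

variable {Ω : Type*} [Field Ω]

theorem diagMat_pow (α : Ω) (m : ℕ) : diagMat α ^ m = diagMat (α ^ m) := by
  induction m with
  | zero => ext i j; fin_cases i <;> fin_cases j <;> simp [diagMat]
  | succ m ih =>
    rw [pow_succ, ih]
    ext i j; fin_cases i <;> fin_cases j <;> simp [diagMat, pow_succ, mul_comm]

theorem diagMat_one : diagMat (1 : Ω) = 1 := by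
  ext i j; fin_cases i <;> fin_cases j <;> simp [diagMat]

theorem swapMat_mul_self : (swapMat : M2 Ω) * swapMat = 1 := by
  ext i j; fin_cases i <;> fin_cases j <;> simp [swapMat]

theorem diagMat_mul_swapMat_mul {α : Ω} (h : α ≠ 0) :
    diagMat α * swapMat * diagMat α = swapMat := by
  ext i j; fin_cases i <;> fin_cases j <;> simp [diagMat, swapMat, h]

theorem Hmap_eq {q : ℕ} (hq : IsCharPow Ω q) (m : ℕ) (X : M2 Ω) :
    Hmap q m X = (powHom hq m).mapMatrix X := by
  ext i j; fin_cases i <;> fin_cases j <;> rfl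

theorem Hmap_diagMat (q m : ℕ) (hq : IsCharPow Ω q) (α : Ω) :
    Hmap q m (diagMat α) = diagMat (α ^ q ^ m) := by
  have h0 := map_zero (powHom hq m)
  rw [powHom_apply] at h0
  ext i j; fin_cases i <;> fin_cases j <;> simp [Hmap, diagMat, h0]

theorem Hmap_swapMat (q m : ℕ) (hq : IsCharPow Ω q) : Hmap q m (swapMat : M2 Ω) = swapMat := by
  have h0 := map_zero (powHom hq m)
  rw [powHom_apply] at h0
  ext i j; fin_cases i <;> fin_cases j <;> simp [Hmap, swapMat, h0]

theorem Hmap_algebraMap {K : Type*} [Field K] [Algebra K Ω] {q m : ℕ} (hq : IsCharPow Ω q)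
    {c d : K} (h : c ^ q ^ m = d) :
    Hmap q m (algebraMap K (M2 Ω) c) = algebraMap K (M2 Ω) d := by
  have h0 := map_zero (powHom hq m)
  rw [powHom_apply] at h0
  subst h
  ext i j; fin_cases i <;> fin_cases j <;> simp [Hmap, Matrix.algebraMap_matrix_apply, h0]

theorem Tmap_eq (q m : ℕ) (X : M2 Ω) : Tmap q m X = swapMat * Hmap q m X * swapMat := by
  ext i j; fin_cases i <;> fin_cases j <;>
    simp [Tmap, Hmap, swapMat, Matrix.mul_apply, Fin.sum_univ_two]

/-- Conjugation by `Zmat α` as an isomorphism of algebras. -/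
def sigmaEquiv (K : Type*) [Field K] [Algebra K Ω] {α : Ω} (h : α ≠ α⁻¹) : M2 Ω ≃ₐ[K] M2 Ω where
  toFun := sigma α
  invFun := sigmaInv α
  left_inv := (sigmaInv_sigma h).1
  right_inv := (sigmaInv_sigma h).2
  map_mul' X Y := by
    have hu := isUnit_det_Zmat h
    simp only [sigma, Matrix.mul_assoc]
    rw [← Matrix.mul_assoc (Zmat α) (Zmat α)⁻¹, Matrix.mul_nonsing_inv _ hu, Matrix.one_mul]
  map_add' X Y := by simp only [sigma, Matrix.mul_add, Matrix.add_mul]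
  commutes' c := by
    have hu := isUnit_det_Zmat h
    simp only [sigma]
    rw [← Algebra.commutes, Matrix.mul_assoc, Matrix.nonsing_inv_mul _ hu, Matrix.mul_one]

theorem eq_sigma_of_Zmat_mul_eq {α : Ω} (h : α ≠ α⁻¹) {X Y : M2 Ω}
    (hXY : Zmat α * Y = X * Zmat α) : sigma α X = Y := by
  rw [sigma, Matrix.mul_assoc, ← hXY, ← Matrix.mul_assoc,
    Matrix.nonsing_inv_mul _ (isUnit_det_Zmat h), Matrix.one_mul]

/-- This explains the choice of `Z`: after conjugation the entries of both generators lie in `K(α +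
α⁻¹)`. -/
theorem sigma_diagMat {α : Ω} (h0 : α ≠ 0) (h : α ≠ α⁻¹) :
    sigma α (diagMat α) = !![0, 1; -1, α + α⁻¹] := by
  apply eq_sigma_of_Zmat_mul_eq h
  ext i j; fin_cases i <;> fin_cases j <;>
    simp [Zmat, diagMat, Matrix.mul_apply, Fin.sum_univ_two] <;> field_simp <;> ring

theorem sigma_swapMat {α : Ω} (h : α ≠ α⁻¹) :
    sigma α swapMat = !![1, -(α + α⁻¹); 0, -1] := by
  apply eq_sigma_of_Zmat_mul_eq h
  ext i j; fin_cases i <;> fin_cases j <;>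
    simp [Zmat, swapMat, Matrix.mul_apply, Fin.sum_univ_two]

theorem aeval_diagMat {K : Type*} [Field K] [Algebra K Ω] (α : Ω) (P : K[X]) :
    aeval (diagMat α) P = !![aeval α P, 0; 0, aeval α⁻¹ P] := by
  have h : ∀ x y : Ω, !![x, 0; 0, y] = Matrix.diagonalAlgHom (n := Fin 2) K ![x, y] := by
    intro x y
    ext i j; fin_cases i <;> fin_cases j <;> simp
  rw [diagMat, h, h, aeval_algHom_apply, aeval_pi_apply]
  congr 1
  ext i; fin_cases i <;> rfl

/-- The first summand is diagonal and the second antidiagonal, so they vanish separately. -/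
theorem aeval_eq_zero_of_diagMat {K : Type*} [Field K] [Algebra K Ω] {α : Ω} {P Q : K[X]}
    (h : aeval (diagMat α) P + swapMat * aeval (diagMat α) Q = 0) :
    (aeval α P = 0 ∧ aeval α⁻¹ P = 0) ∧ aeval α Q = 0 ∧ aeval α⁻¹ Q = 0 := by
  rw [aeval_diagMat, aeval_diagMat] at h
  have h1 := fun i j => congrFun (congrFun h i) j
  have h00 := h1 0 0
  have h01 := h1 0 1
  have h10 := h1 1 0
  have h11 := h1 1 1
  simp [swapMat] at h00 h01 h10 h11
  exact ⟨⟨h00, h11⟩, h10, h01⟩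

theorem aeval_eq_zero_of_sigma {K : Type*} [Field K] [Algebra K Ω] {α : Ω} (hα : α ≠ α⁻¹)
    {P Q : K[X]}
    (h : aeval (sigma α (diagMat α)) P + sigma α swapMat * aeval (sigma α (diagMat α)) Q = 0) :
    (aeval α P = 0 ∧ aeval α⁻¹ P = 0) ∧ aeval α Q = 0 ∧ aeval α⁻¹ Q = 0 := by
  apply aeval_eq_zero_of_diagMat
  apply (sigmaEquiv K hα).injective
  rw [map_zero, map_add, map_mul, ← aeval_algHom_apply, ← aeval_algHom_apply]
  exact h

end Matrices

/-! ### Dimensions of the blocks -/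

section Blocks

variable {K Ω : Type*} [Field K] [Field Ω] [Algebra K Ω]

theorem mem_matOver {L : IntermediateField K Ω} {a b c d : Ω} (ha : a ∈ L) (hb : b ∈ L)
    (hc : c ∈ L) (hd : d ∈ L) : !![a, b; c, d] ∈ matOver L := by
  refine ⟨!![⟨a, ha⟩, ⟨b, hb⟩; ⟨c, hc⟩, ⟨d, hd⟩], ?_⟩
  ext i j; fin_cases i <;> fin_cases j <;> rfl

theorem finrank_matOver (L : IntermediateField K Ω) [FiniteDimensional K L] :
    Module.Finite K (matOver L) ∧ Module.finrank K (matOver L) = 4 * Module.finrank K L := by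
  have hinj : Function.Injective (L.val.mapMatrix : M2 L →ₐ[K] M2 Ω) := by
    intro X Y h
    ext i j
    exact congrFun (congrFun h i) j
  let e : M2 L ≃ₗ[K] matOver L := (AlgEquiv.ofInjective _ hinj).toLinearEquiv
  refine ⟨Module.Finite.equiv e, ?_⟩
  rw [← e.finrank_eq, Module.finrank_matrix]
  simp

theorem finrank_subalgebra_prod {A B : Type*} [Ring A] [Ring B] [Algebra K A] [Algebra K B]
    (S : Subalgebra K A) (T : Subalgebra K B) [Module.Finite K S] [Module.Finite K T] :
    Module.Finite K (S.prod T) ∧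
      Module.finrank K (S.prod T) = Module.finrank K S + Module.finrank K T := by
  let e : (S × T) ≃ₗ[K] S.prod T :=
    { toFun := fun x => ⟨(x.1, x.2), x.1.2, x.2.2⟩
      invFun := fun x => (⟨x.1.1, x.2.1⟩, ⟨x.1.2, x.2.2⟩)
      left_inv := fun _ => rfl
      right_inv := fun _ => rfl
      map_add' := fun _ _ => rfl
      map_smul' := fun _ _ => rfl }
  exact ⟨Module.Finite.equiv e, by rw [← e.finrank_eq, Module.finrank_prod]⟩

/-- Since the swap matrix squares to one, it and the identity span the algebra. -/
theorem finrank_adjoin_swapMat :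
    Module.Finite K (Algebra.adjoin K {(swapMat : M2 Ω)}) ∧
      Module.finrank K (Algebra.adjoin K {(swapMat : M2 Ω)}) ≤ 2 := by
  let s : Algebra.adjoin K {(swapMat : M2 Ω)} := ⟨swapMat, Algebra.self_mem_adjoin_singleton K _⟩
  let φ : K × K →ₗ[K] Algebra.adjoin K {(swapMat : M2 Ω)} :=
    (LinearMap.toSpanSingleton K _ 1).coprod (LinearMap.toSpanSingleton K _ s)
  have hφ : Function.Surjective φ := by
    rintro ⟨x, hx⟩
    suffices ∃ a b : K, a • (1 : M2 Ω) + b • swapMat = x by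
      obtain ⟨a, b, h⟩ := this
      exact ⟨(a, b), Subtype.ext h⟩
    induction hx using Algebra.adjoin_induction with
    | mem x hx => exact ⟨0, 1, by rw [Set.mem_singleton_iff.1 hx]; simp⟩
    | algebraMap c => exact ⟨c, 0, by simp [Algebra.algebraMap_eq_smul_one]⟩
    | add x y _ _ hx hy =>
      obtain ⟨a, b, rfl⟩ := hx
      obtain ⟨c, d, rfl⟩ := hy
      exact ⟨a + c, b + d, by module⟩
    | mul x y _ _ hx hy =>
      obtain ⟨a, b, rfl⟩ := hx
      obtain ⟨c, d, rfl⟩ := hy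
      refine ⟨a * c + b * d, a * d + b * c, ?_⟩
      simp only [add_mul, mul_add, smul_mul_smul_comm, swapMat_mul_self, one_mul, mul_one]
      module
  refine ⟨Module.Finite.of_surjective φ hφ, ?_⟩
  have := LinearMap.finrank_le_finrank_of_surjective hφ
  simpa using this

end Blocks

/-! ### The representation attached to each kind of block -/

/-- The elements `A` and `b` of the subalgebra `S` satisfy the relations of the dihedral group of
order `2 * n` and are fixed by the `q`-semilinear ring endomorphism `ψ`; the representation of the
group algebra that they define has its kernel controlled by `G`, and `S` has dimension at most
`2 * deg G`. -/
structure IsBlockRep {K B : Type*} [Field K] [Ring B] [Algebra K B] (q n : ℕ) (S : Subalgebra K B)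
    (A b : B) (ψ : B → B) (G : K[X]) : Prop where
  pow_eq : A ^ n = 1
  mul_self : b * b = 1
  mul_mul : A * b * A = b
  memA : A ∈ S
  memb : b ∈ S
  hom : ∃ Ψ : B →+* B, (∀ x, Ψ x = ψ x) ∧ Ψ A = A ∧ Ψ b = b ∧
    ∀ c : K, Ψ (algebraMap K B c) = algebraMap K B (c ^ q)
  dvd : ∀ P Q : K[X], aeval A P + b * aeval A Q = 0 →
    ∀ g : K[X], Irreducible g → g ∣ G → g ∣ P ∧ g ∣ Q
  finite : Module.Finite K S
  finrank_le : Module.finrank K S ≤ 2 * G.natDegree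

section BlockReps

variable {K Ω : Type*} [Field K] [Field Ω] [Algebra K Ω] {q n : ℕ}

theorem kind_J0odd {f : K[X]} (h : kind q f = .J0odd) :
    f = conjPoly q f ∧ f = recipPoly f ∧ ringChar K ≠ 2 := by
  unfold kind at h
  split_ifs at h with h1 h2
  exact ⟨h1.1, h1.2, h2⟩

theorem kind_J0two {f : K[X]} (h : kind q f = .J0two) :
    f = conjPoly q f ∧ f = recipPoly f ∧ ringChar K = 2 := by
  unfold kind at h
  split_ifs at h with h1 h2
  exact ⟨h1.1, h1.2, h2⟩

theorem kind_J1 {f : K[X]} (h : kind q f = .J1) : f ≠ conjPoly q f ∧ f = recipPoly f := by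
  unfold kind at h
  split_ifs at h with h1 h2 h3
  exact ⟨fun h' => h1 ⟨h', h3⟩, h3⟩

theorem kind_J2 {f : K[X]} (h : kind q f = .J2) : f = conjPoly q f := by
  unfold kind at h
  split_ifs at h with h1 h2 h3 h4
  exact h4

theorem kind_J3 {f : K[X]} (h : kind q f = .J3) : conjPoly q f = recipPoly f := by
  unfold kind at h
  split_ifs at h with h1 h2 h3 h4 h5
  exact h5

theorem prime_dvd_of_dvd_mul {f₁ f₂ g P : K[X]} (hg : Irreducible g) (h : g ∣ f₁ * f₂)
    (h1 : g ∣ f₁ → g ∣ P) (h2 : g ∣ f₂ → g ∣ P) : g ∣ P :=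
  (hg.prime.dvd_or_dvd h).elim h1 h2

theorem dvd_of_common_root' {f g P : K[X]} {α : Ω} (hf : Irreducible f) (h : aeval α f = 0)
    (hP : aeval α P = 0) (hg : g ∣ f) : g ∣ P :=
  hg.trans (dvd_of_common_root hf h hP)

theorem dvd_of_dvd_mul_recipPoly {f g P : K[X]} {α : Ω} (hf : Irreducible f) (h0 : α ≠ 0)
    (hc : f.coeff 0 ≠ 0) (h : aeval α f = 0) (hP : aeval α P = 0) (hP' : aeval α⁻¹ P = 0)
    (hg : Irreducible g) (hd : g ∣ f * recipPoly f) : g ∣ P :=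
  prime_dvd_of_dvd_mul hg hd (dvd_of_common_root' hf h hP)
    (dvd_of_common_root' (recipPoly_irreducible hf hc) (aeval_recipPoly h0 h) hP')

/-- Even powers of `x ↦ x ^ q` are trivial on `K`; thus every odd exponent in the formulas for `φ`
gives the same action on scalars. -/
theorem pow_odd_eq [Finite K] (hK : Nat.card K = q ^ 2) {m : ℕ} (hm : Odd m) (c : K) :
    c ^ q ^ m = c ^ q := by
  obtain ⟨s, rfl⟩ := hm
  have : Fintype K := Fintype.ofFinite K
  rw [pow_pow_add, pow_mul, ← hK, Nat.card_eq_fintype_card, FiniteField.pow_card_pow, pow_one]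

theorem aeval_conj_root (hq : IsCharPow K q) {f : K[X]} {α : Ω} (h : aeval α f = 0) :
    aeval (α ^ q) (conjPoly q f) = 0 := by
  rw [aeval_conjPoly hq, h, ← pow_one q]
  exact map_zero (powHom (hq.of_algebra Ω) 1)

theorem isBlockRep_J0odd [Finite K] (hK : Nat.card K = q ^ 2) {f : K[X]} (hf : Irreducible f)
    {α : Ω} (h : aeval α f = 0) (hα : α ^ n = 1) (h1 : α = 1 ∨ α = -1) (h2 : ringChar K ≠ 2) :
    IsBlockRep q n ((⊥ : Subalgebra K Ω).prod ⊥) (α, α) (1, -1)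
      (fun x : Ω × Ω => (x.1 ^ q, x.2 ^ q)) f := by
  have hq := isCharPow_of_card hK
  have hq' := hq.of_algebra Ω
  have hmem : α ∈ (⊥ : Subalgebra K Ω) := by
    rcases h1 with rfl | rfl
    · exact one_mem _
    · exact neg_mem (one_mem _)
  have hαα : α * α = 1 := by rcases h1 with rfl | rfl <;> simp
  have hfix : ∀ m, powHom hq' m α = α := by
    intro m
    rcases h1 with rfl | rfl
    · exact map_one _
    · rw [map_neg, map_one]
  have hdeg : 0 < f.natDegree := hf.natDegree_pos
  obtain ⟨hfin, hrank⟩ := finrank_subalgebra_prod (⊥ : Subalgebra K Ω) (⊥ : Subalgebra K Ω)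
  have hpw : ∀ x : Ω, powHom hq' 1 x = x ^ q := fun x => by rw [powHom_apply, pow_one]
  have h2' : (2 : Ω) ≠ 0 := by
    rw [← map_ofNat (algebraMap K Ω) 2, Ne, map_eq_zero]
    exact Ring.two_ne_zero h2
  refine ⟨by ext <;> simp [hα], by ext <;> simp, by ext <;> simp [hαα], ⟨hmem, hmem⟩,
    ⟨one_mem _, neg_mem (one_mem _)⟩,
    ⟨(powHom hq' 1).prodMap (powHom hq' 1), fun x => ?_, ?_, ?_, fun c => ?_⟩, ?_, hfin, ?_⟩
  · exact Prod.ext (hpw _) (hpw _)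
  · exact Prod.ext (hfix 1) (hfix 1)
  · exact Prod.ext (map_one (powHom hq' 1)) ((map_neg (powHom hq' 1) 1).trans (by rw [map_one]))
  · rw [RingHom.coe_prodMap, Prod.algebraMap_apply, Prod.algebraMap_apply, Prod.map_apply, hpw,
      map_pow]
  · intro P Q hPQ g hg hgf
    rw [aeval_prod_apply, aeval_prod_apply] at hPQ
    have e1 := congrArg Prod.fst hPQ
    have e2 := congrArg Prod.snd hPQ
    simp at e1 e2
    -- The two components are `P(α) + Q(α)` and `P(α) - Q(α)`; characteristic different from two
    -- separates them.
    have e3 : aeval α P = 0 := by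
      have : (2 : Ω) * aeval α P = 0 := by linear_combination e1 + e2
      exact (mul_eq_zero.1 this).resolve_left h2'
    rw [e3, zero_add] at e1
    exact ⟨dvd_of_common_root' hf h e3 hgf, dvd_of_common_root' hf h e1 hgf⟩
  · rw [hrank, Subalgebra.finrank_bot]
    lia

theorem hom_Hmap [Finite K] (hK : Nat.card K = q ^ 2) {α : Ω} {m : ℕ} (hm : Odd m)
    (hα : α ^ q ^ m = α) :
    ∃ Ψ : M2 Ω →+* M2 Ω, (∀ x, Ψ x = Hmap q m x) ∧ Ψ (diagMat α) = diagMat α ∧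
      Ψ swapMat = swapMat ∧
      ∀ c : K, Ψ (algebraMap K (M2 Ω) c) = algebraMap K (M2 Ω) (c ^ q) := by
  have hq' := (isCharPow_of_card hK).of_algebra Ω
  refine ⟨(powHom hq' m).mapMatrix, fun x => (Hmap_eq hq' m x).symm, ?_, ?_, fun c => ?_⟩
  · rw [← Hmap_eq, Hmap_diagMat q m hq', hα]
  · rw [← Hmap_eq, Hmap_swapMat q m hq']
  · rw [← Hmap_eq, Hmap_algebraMap hq' (pow_odd_eq hK hm c)]

theorem isBlockRep_J0two [Finite K] (hK : Nat.card K = q ^ 2) {f : K[X]} (hf : Irreducible f)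
    (h : aeval (1 : Ω) f = 0) :
    IsBlockRep q n (Algebra.adjoin K {(swapMat : M2 Ω)}) 1 swapMat (fun X => Hmap q 1 X) f := by
  have hdeg : 0 < f.natDegree := hf.natDegree_pos
  obtain ⟨hfin, hrank⟩ := finrank_adjoin_swapMat (K := K) (Ω := Ω)
  refine ⟨one_pow _, swapMat_mul_self, by rw [one_mul, mul_one], one_mem _,
    Algebra.self_mem_adjoin_singleton K _, ?_, ?_, hfin, by lia⟩
  · rw [← diagMat_one]
    exact hom_Hmap hK odd_one (one_pow _)
  · intro P Q hPQ g hg hgf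
    -- The rotation acts as the diagonal matrix attached to `α = 1`, so the general criterion
    -- applies.
    rw [← diagMat_one] at hPQ
    obtain ⟨⟨hP, -⟩, hQ, -⟩ := aeval_eq_zero_of_diagMat hPQ
    exact ⟨dvd_of_common_root' hf h hP hgf, dvd_of_common_root' hf h hQ hgf⟩

/-- Serves both `J₂` and `J₃`, which differ only in the semilinear map; hence `ψ` is left arbitrary.
-/
theorem isBlockRep_matOver {f : K[X]} (hm : f.Monic) (hf : Irreducible f)
    {α : Ω} (h0 : α ≠ 0) (hc : f.coeff 0 ≠ 0) (h : aeval α f = 0) (hα : α ^ n = 1)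
    {ψ : M2 Ω → M2 Ω}
    (hψ : ∃ Ψ : M2 Ω →+* M2 Ω, (∀ x, Ψ x = ψ x) ∧ Ψ (diagMat α) = diagMat α ∧
      Ψ swapMat = swapMat ∧
      ∀ c : K, Ψ (algebraMap K (M2 Ω) c) = algebraMap K (M2 Ω) (c ^ q)) :
    IsBlockRep q n (matOver K⟮α⟯) (diagMat α) swapMat ψ (f * recipPoly f) := by
  obtain ⟨hfd, hr⟩ := finrank_adjoin_root hm hf h
  obtain ⟨hfin, hrank⟩ := finrank_matOver K⟮α⟯
  have hmem := IntermediateField.mem_adjoin_simple_self K α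
  refine ⟨by rw [diagMat_pow, hα, diagMat_one], swapMat_mul_self, diagMat_mul_swapMat_mul h0,
    mem_matOver hmem (zero_mem _) (zero_mem _) (inv_mem hmem),
    mem_matOver (zero_mem _) (one_mem _) (one_mem _) (zero_mem _), hψ, ?_, hfin, ?_⟩
  · intro P Q hPQ g hg hgf
    obtain ⟨⟨hP, hP'⟩, hQ, hQ'⟩ := aeval_eq_zero_of_diagMat hPQ
    exact ⟨dvd_of_dvd_mul_recipPoly hf h0 hc h hP hP' hg hgf,
      dvd_of_dvd_mul_recipPoly hf h0 hc h hQ hQ' hg hgf⟩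
  · rw [natDegree_mul hf.ne_zero (recipPoly_irreducible hf hc).ne_zero, natDegree_recipPoly hc]
    lia

/-- Raising entries to the power `q ^ r` inverts `α`; the conjugation by the swap matrix contained
in `T ^ r` exchanges the diagonal entries back. -/
theorem isBlockRep_J3 [Finite K] (hK : Nat.card K = q ^ 2) {f : K[X]} (hm : f.Monic)
    (hf : Irreducible f) {α : Ω} (h0 : α ≠ 0) (hc : f.coeff 0 ≠ 0) (h : aeval α f = 0)
    (hα : α ^ n = 1) {r : ℕ} (hr : Odd r) (hαr : α ^ q ^ r = α⁻¹) :
    IsBlockRep q n (matOver K⟮α⟯) (diagMat α) swapMat (fun X => Tmap q r X)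
      (f * recipPoly f) := by
  have hq' := (isCharPow_of_card hK).of_algebra Ω
  refine isBlockRep_matOver hm hf h0 hc h hα ?_
  let s : (M2 Ω)ˣ := ⟨swapMat, swapMat, swapMat_mul_self, swapMat_mul_self⟩
  let c : M2 Ω →+* M2 Ω :=
    MulSemiringAction.toRingHom (ConjAct (M2 Ω)ˣ) (M2 Ω) (ConjAct.toConjAct s)
  have hc' : ∀ X, c X = swapMat * X * swapMat := fun X => rfl
  have hψ : ∀ X, (c.comp (powHom hq' r).mapMatrix) X = Tmap q r X := fun X => by
    rw [Tmap_eq, Hmap_eq hq', RingHom.comp_apply, hc']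
  refine ⟨_, hψ, ?_, ?_, fun x => ?_⟩
  · rw [hψ, Tmap_eq, Hmap_diagMat q r hq', hαr]
    ext i j; fin_cases i <;> fin_cases j <;> simp [diagMat, swapMat]
  · rw [hψ, Tmap_eq, Hmap_swapMat q r hq', swapMat_mul_self, one_mul]
  · rw [hψ, Tmap_eq, Hmap_algebraMap hq' (pow_odd_eq hK hr x), ← Algebra.commutes, mul_assoc,
      swapMat_mul_self, mul_one]

/-- The map `(X, Y) ↦ (Ψ₁ Y, Ψ₂ X)`. -/
def crossHom {A B : Type*} [Ring A] [Ring B] (Ψ₁ : B →+* A) (Ψ₂ : A →+* B) : A × B →+* A × B :=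
  (Ψ₁.comp (RingHom.snd A B)).prod (Ψ₂.comp (RingHom.fst A B))

theorem crossHom_apply {A B : Type*} [Ring A] [Ring B] (Ψ₁ : B →+* A) (Ψ₂ : A →+* B)
    (x : A × B) : crossHom Ψ₁ Ψ₂ x = (Ψ₁ x.2, Ψ₂ x.1) := rfl

/-- Each summand has dimension `4 [K(α + α⁻¹) : K] ≤ 2r`, or the same with `α ^ q`, in total at most
`4r`, which is twice the degree of the orbit product. -/
theorem isBlockRep_J1 [Finite K] (hK : Nat.card K = q ^ 2) {f : K[X]} (hm : f.Monic)
    (hf : Irreducible f) {α : Ω} (h0 : α ≠ 0) (h : aeval α f = 0) (h' : aeval α⁻¹ f = 0)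
    (hne : α ≠ α⁻¹) (hα : α ^ n = 1) :
    IsBlockRep q n ((matOver K⟮α + α⁻¹⟯).prod (matOver K⟮α ^ q + (α ^ q)⁻¹⟯))
      (sigma α (diagMat α), sigma (α ^ q) (diagMat (α ^ q)))
      (sigma α swapMat, sigma (α ^ q) swapMat)
      (fun X : M2 Ω × M2 Ω => (sigma α (Hmap q (2 * f.natDegree - 1) (sigmaInv (α ^ q) X.2)),
        sigma (α ^ q) (Hmap q 1 (sigmaInv α X.1)))) (f * conjPoly q f) := by
  have hq := isCharPow_of_card hK
  have hq' := hq.of_algebra Ω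
  have hpos : 0 < f.natDegree := hf.natDegree_pos
  have hβ0 : α ^ q ≠ 0 := pow_ne_zero _ h0
  have hβn : (α ^ q) ^ n = 1 := by rw [← pow_mul, mul_comm, pow_mul, hα, one_pow]
  have hβ : aeval (α ^ q) (conjPoly q f) = 0 := aeval_conj_root hq h
  have hβ' : aeval (α ^ q)⁻¹ (conjPoly q f) = 0 := by
    rw [← inv_pow]
    exact aeval_conj_root hq h'
  have hβne : α ^ q ≠ (α ^ q)⁻¹ := by
    rw [← inv_pow, ← pow_one q]
    exact (hq'.pow_injective 1).ne hne
  have hmc : (conjPoly q f).Monic := by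
    rw [conjPoly_eq_map hq]
    exact hm.map _
  have hfc := conjPoly_irreducible hq hf
  -- The exponent `2r - 1` completes the first `q`-th power to the `q ^ (2r)`-th power, which fixes
  -- `α`.
  have hback : (α ^ q) ^ q ^ (2 * f.natDegree - 1) = α := by
    have := (natDegree_dvd_iff_pow_eq hK hf h f.natDegree).1 dvd_rfl
    rwa [show 2 * f.natDegree = 1 + (2 * f.natDegree - 1) by lia, pow_pow_add, pow_one] at this
  have hodd : Odd (2 * f.natDegree - 1) := ⟨f.natDegree - 1, by lia⟩
  obtain ⟨hfd, hr⟩ := finrank_adjoin_add_inv hK hm hf h h' hne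
  obtain ⟨hfd', hr'⟩ := finrank_adjoin_add_inv hK hmc hfc hβ hβ' hβne
  obtain ⟨hfin, hrank⟩ := finrank_matOver K⟮α + α⁻¹⟯
  obtain ⟨hfin', hrank'⟩ := finrank_matOver K⟮α ^ q + (α ^ q)⁻¹⟯
  obtain ⟨hfin2, hrank2⟩ := finrank_subalgebra_prod (matOver K⟮α + α⁻¹⟯)
    (matOver K⟮α ^ q + (α ^ q)⁻¹⟯)
  have hmem := IntermediateField.mem_adjoin_simple_self K (α + α⁻¹)
  have hmem' := IntermediateField.mem_adjoin_simple_self K (α ^ q + (α ^ q)⁻¹)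
  let s := sigmaEquiv K hne
  let s' := sigmaEquiv K hβne
  have hs : ∀ X, s X = sigma α X := fun _ => rfl
  have hs' : ∀ X, s' X = sigma (α ^ q) X := fun _ => rfl
  have hsi : ∀ X, s.symm X = sigmaInv α X := fun _ => rfl
  have hsi' : ∀ X, s'.symm X = sigmaInv (α ^ q) X := fun _ => rfl
  simp only [← hs, ← hs', ← hsi, ← hsi']
  refine ⟨?_, ?_, ?_, ⟨?_, ?_⟩, ⟨?_, ?_⟩, ⟨crossHom
    ((s : M2 Ω →+* M2 Ω).comp ((powHom hq' (2 * f.natDegree - 1)).mapMatrix.comp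
      (s'.symm : M2 Ω →+* M2 Ω)))
    ((s' : M2 Ω →+* M2 Ω).comp ((powHom hq' 1).mapMatrix.comp (s.symm : M2 Ω →+* M2 Ω))), ?_⟩,
    ?_, hfin2, ?_⟩
  · rw [Prod.pow_mk, ← map_pow, ← map_pow, diagMat_pow, diagMat_pow, hα, hβn, diagMat_one,
      map_one, map_one, Prod.mk_one_one]
  · rw [Prod.mk_mul_mk, ← map_mul, ← map_mul, swapMat_mul_self, map_one, map_one, Prod.mk_one_one]
  · simp only [Prod.mk_mul_mk, ← map_mul, diagMat_mul_swapMat_mul h0, diagMat_mul_swapMat_mul hβ0]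
  · rw [hs, sigma_diagMat h0 hne]
    exact mem_matOver (zero_mem _) (one_mem _) (neg_mem (one_mem _)) hmem
  · rw [hs', sigma_diagMat hβ0 hβne]
    exact mem_matOver (zero_mem _) (one_mem _) (neg_mem (one_mem _)) hmem'
  · rw [hs, sigma_swapMat hne]
    exact mem_matOver (one_mem _) (neg_mem hmem) (zero_mem _) (neg_mem (one_mem _))
  · rw [hs', sigma_swapMat hβne]
    exact mem_matOver (one_mem _) (neg_mem hmem') (zero_mem _) (neg_mem (one_mem _))
  · have key : ∀ X : M2 Ω × M2 Ω, crossHom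
        ((s : M2 Ω →+* M2 Ω).comp ((powHom hq' (2 * f.natDegree - 1)).mapMatrix.comp
          (s'.symm : M2 Ω →+* M2 Ω)))
        ((s' : M2 Ω →+* M2 Ω).comp ((powHom hq' 1).mapMatrix.comp (s.symm : M2 Ω →+* M2 Ω))) X =
        (s (Hmap q (2 * f.natDegree - 1) (s'.symm X.2)), s' (Hmap q 1 (s.symm X.1))) := by
      intro X
      rw [Hmap_eq hq', Hmap_eq hq']
      rfl
    refine ⟨key, ?_, ?_, fun c => ?_⟩
    · rw [key, AlgEquiv.symm_apply_apply, AlgEquiv.symm_apply_apply, Hmap_diagMat _ _ hq',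
        Hmap_diagMat _ _ hq', hback, pow_one]
    · rw [key, AlgEquiv.symm_apply_apply, AlgEquiv.symm_apply_apply, Hmap_swapMat _ _ hq',
        Hmap_swapMat _ _ hq']
    · rw [key, Prod.algebraMap_apply, Prod.algebraMap_apply, AlgEquiv.commutes,
        AlgEquiv.commutes, Hmap_algebraMap hq' (pow_odd_eq hK hodd c),
        Hmap_algebraMap hq' (pow_odd_eq hK odd_one c), AlgEquiv.commutes, AlgEquiv.commutes]
  · intro P Q hPQ g hg hgf
    rw [aeval_prod_apply, aeval_prod_apply] at hPQ
    obtain ⟨⟨hP, -⟩, hQ, -⟩ := aeval_eq_zero_of_sigma hne (congrArg Prod.fst hPQ)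
    obtain ⟨⟨hP', -⟩, hQ', -⟩ := aeval_eq_zero_of_sigma hβne (congrArg Prod.snd hPQ)
    exact ⟨prime_dvd_of_dvd_mul hg hgf (dvd_of_common_root' hf h hP)
      (dvd_of_common_root' hfc hβ hP'),
      prime_dvd_of_dvd_mul hg hgf (dvd_of_common_root' hf h hQ)
      (dvd_of_common_root' hfc hβ hQ')⟩
  · rw [natDegree_conjPoly hq] at hr'
    rw [natDegree_mul hf.ne_zero hfc.ne_zero, natDegree_conjPoly hq]
    lia

theorem isBlockRep_J4 [Finite K] (hK : Nat.card K = q ^ 2) {f : K[X]} (hm : f.Monic)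
    (hf : Irreducible f) {α : Ω} (h0 : α ≠ 0) (hc : f.coeff 0 ≠ 0) (h : aeval α f = 0)
    (hα : α ^ n = 1) :
    IsBlockRep q n ((matOver K⟮α⟯).prod (matOver K⟮α ^ q⟯))
      (diagMat α, diagMat (α ^ q)) (swapMat, swapMat)
      (fun X : M2 Ω × M2 Ω => (Hmap q (2 * f.natDegree - 1) X.2, Hmap q 1 X.1))
      (f * recipPoly f * conjPoly q f * conjPoly q (recipPoly f)) := by
  have hq := isCharPow_of_card hK
  have hq' := hq.of_algebra Ω
  have hpos : 0 < f.natDegree := hf.natDegree_pos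
  have hβ0 : α ^ q ≠ 0 := pow_ne_zero _ h0
  have hβn : (α ^ q) ^ n = 1 := by rw [← pow_mul, mul_comm, pow_mul, hα, one_pow]
  have hβ : aeval (α ^ q) (conjPoly q f) = 0 := aeval_conj_root hq h
  have hβ' : aeval (α ^ q)⁻¹ (conjPoly q (recipPoly f)) = 0 := by
    rw [← inv_pow]
    exact aeval_conj_root hq (aeval_recipPoly h0 h)
  have hmc : (conjPoly q f).Monic := by
    rw [conjPoly_eq_map hq]
    exact hm.map _
  have hfc := conjPoly_irreducible hq hf
  have hfr := recipPoly_irreducible hf hc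
  have hfrc := conjPoly_irreducible hq hfr
  have hback : (α ^ q) ^ q ^ (2 * f.natDegree - 1) = α := by
    have := (natDegree_dvd_iff_pow_eq hK hf h f.natDegree).1 dvd_rfl
    rwa [show 2 * f.natDegree = 1 + (2 * f.natDegree - 1) by lia, pow_pow_add, pow_one] at this
  have hodd : Odd (2 * f.natDegree - 1) := ⟨f.natDegree - 1, by lia⟩
  obtain ⟨hfd, hr⟩ := finrank_adjoin_root hm hf h
  obtain ⟨hfd', hr'⟩ := finrank_adjoin_root hmc hfc hβ
  obtain ⟨hfin, hrank⟩ := finrank_matOver K⟮α⟯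
  obtain ⟨hfin', hrank'⟩ := finrank_matOver K⟮α ^ q⟯
  obtain ⟨hfin2, hrank2⟩ := finrank_subalgebra_prod (matOver K⟮α⟯) (matOver K⟮α ^ q⟯)
  have hmem := IntermediateField.mem_adjoin_simple_self K α
  have hmem' := IntermediateField.mem_adjoin_simple_self K (α ^ q)
  have hswap : ∀ L : IntermediateField K Ω, swapMat ∈ matOver L := fun L =>
    mem_matOver (zero_mem _) (one_mem _) (one_mem _) (zero_mem _)
  refine ⟨?_, ?_, ?_, ⟨?_, ?_⟩, ⟨hswap _, hswap _⟩,
    ⟨crossHom (powHom hq' (2 * f.natDegree - 1)).mapMatrix (powHom hq' 1).mapMatrix, ?_⟩,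
    ?_, hfin2, ?_⟩
  · rw [Prod.pow_mk, diagMat_pow, diagMat_pow, hα, hβn, diagMat_one, Prod.mk_one_one]
  · rw [Prod.mk_mul_mk, swapMat_mul_self, Prod.mk_one_one]
  · rw [Prod.mk_mul_mk, Prod.mk_mul_mk, diagMat_mul_swapMat_mul h0, diagMat_mul_swapMat_mul hβ0]
  · exact mem_matOver hmem (zero_mem _) (zero_mem _) (inv_mem hmem)
  · exact mem_matOver hmem' (zero_mem _) (zero_mem _) (inv_mem hmem')
  · have key : ∀ X : M2 Ω × M2 Ω,
        crossHom (powHom hq' (2 * f.natDegree - 1)).mapMatrix (powHom hq' 1).mapMatrix X =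
        (Hmap q (2 * f.natDegree - 1) X.2, Hmap q 1 X.1) := by
      intro X
      rw [Hmap_eq hq', Hmap_eq hq', crossHom_apply]
    refine ⟨key, ?_, ?_, fun c => ?_⟩
    · rw [key, Hmap_diagMat _ _ hq', Hmap_diagMat _ _ hq', hback, pow_one]
    · rw [key, Hmap_swapMat _ _ hq', Hmap_swapMat _ _ hq']
    · rw [key, Prod.algebraMap_apply, Prod.algebraMap_apply,
        Hmap_algebraMap hq' (pow_odd_eq hK hodd c), Hmap_algebraMap hq' (pow_odd_eq hK odd_one c)]
  · intro P Q hPQ g hg hgf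
    rw [aeval_prod_apply, aeval_prod_apply] at hPQ
    obtain ⟨⟨hP, hPi⟩, hQ, hQi⟩ := aeval_eq_zero_of_diagMat (congrArg Prod.fst hPQ)
    obtain ⟨⟨hP', hPi'⟩, hQ', hQi'⟩ := aeval_eq_zero_of_diagMat (congrArg Prod.snd hPQ)
    -- The four factors have the roots `α`, `α⁻¹`, `α ^ q` and `α ^ (-q)`, the diagonal entries of
    -- the two components.
    constructor
    · refine prime_dvd_of_dvd_mul hg hgf (fun hd => prime_dvd_of_dvd_mul hg hd
        (dvd_of_dvd_mul_recipPoly hf h0 hc h hP hPi hg) (dvd_of_common_root' hfc hβ hP'))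
        (dvd_of_common_root' hfrc hβ' hPi')
    · refine prime_dvd_of_dvd_mul hg hgf (fun hd => prime_dvd_of_dvd_mul hg hd
        (dvd_of_dvd_mul_recipPoly hf h0 hc h hQ hQi hg) (dvd_of_common_root' hfc hβ hQ'))
        (dvd_of_common_root' hfrc hβ' hQi')
  · rw [natDegree_mul (mul_ne_zero (mul_ne_zero hf.ne_zero hfr.ne_zero) hfc.ne_zero) hfrc.ne_zero,
      natDegree_mul (mul_ne_zero hf.ne_zero hfr.ne_zero) hfc.ne_zero,
      natDegree_mul hf.ne_zero hfr.ne_zero, natDegree_conjPoly hq, natDegree_conjPoly hq,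
      natDegree_recipPoly hc]
    rw [natDegree_conjPoly hq] at hr'
    lia

theorem isBlockRep_block [Finite K] (hK : Nat.card K = q ^ 2) {f : K[X]} (hm : f.Monic)
    (hf : Irreducible f) {α : Ω} (h0 : α ≠ 0) (hc : f.coeff 0 ≠ 0) (h : aeval α f = 0)
    (hα : α ^ n = 1) (k : Kind) (hk : kind q f = k) :
    IsBlockRep q n (block K q α k) (rhoA q f α k) (rhoB q α k) (phi q f.natDegree α k)
      (orbitProd q f) := by
  unfold orbitProd
  rw [hk]
  cases k with
  | J0odd =>
    obtain ⟨h1, h2, h3⟩ := kind_J0odd hk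
    have h4 := eq_one_or_of_eq_inv h0 (eq_inv_of_self_conj_of_self_recip hK hf h0 h h1 h2)
    -- The case distinction in the definition amounts to `α = 1` or `α = -1`.
    have hA : rhoA q f α .J0odd = ((α, α) : Ω × Ω) := by
      by_cases h5 : f = X - 1
      · rw [h5, map_sub, aeval_X, map_one, sub_eq_zero] at h
        rw [h]
        exact if_pos h5
      · rcases h4 with rfl | rfl
        · refine absurd ?_ h5
          rw [eq_X_sub_C_of_root hm hf (Ω := Ω) (a := 1) (by rwa [map_one]), C_1]
        · exact if_neg h5
    rw [hA]
    exact isBlockRep_J0odd hK hf h hα h4 h3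
  | J0two =>
    obtain ⟨h1, h2, h3⟩ := kind_J0two hk
    have h4 := eq_one_or_of_eq_inv h0 (eq_inv_of_self_conj_of_self_recip hK hf h0 h h1 h2)
    have : CharP K 2 := ringChar.of_eq h3
    have : CharP Ω 2 := charP_of_injective_algebraMap (algebraMap K Ω).injective 2
    rw [CharTwo.neg_eq, or_self] at h4
    subst h4
    exact isBlockRep_J0two hK hf h
  | J1 =>
    obtain ⟨h1, h2⟩ := kind_J1 hk
    have h' : aeval α⁻¹ f = 0 := h2 ▸ aeval_recipPoly h0 h
    exact isBlockRep_J1 hK hm hf h0 h h' (fun he => h1 (eq_conjPoly_of_eq_inv hK hm hf h0 h he)) hα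
  | J2 =>
    obtain ⟨h1, h2⟩ := odd_natDegree_of_eq_conjPoly hK hf h (kind_J2 hk)
    exact isBlockRep_matOver hm hf h0 hc h hα (hom_Hmap hK h1 h2)
  | J3 =>
    obtain ⟨h1, h2⟩ := odd_natDegree_of_conjPoly_eq_recipPoly hK hf h0 h (kind_J3 hk)
    exact isBlockRep_J3 hK hm hf h0 hc h hα h1 h2
  | J4 => exact isBlockRep_J4 hK hm hf h0 hc h hα

end BlockReps

/-! ### Divisibility by squarefree polynomials and homomorphisms from the dihedral group -/

theorem dvd_of_squarefree {K : Type*} [Field K] {S P : K[X]} (hS : Squarefree S)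
    (h : ∀ g, Irreducible g → g ∣ S → g ∣ P) : S ∣ P := by
  classical
  rcases eq_or_ne P 0 with rfl | hP
  · exact dvd_zero S
  have hS0 := hS.ne_zero
  rw [UniqueFactorizationMonoid.dvd_iff_normalizedFactors_le_normalizedFactors hS0 hP,
    Multiset.le_iff_subset ((UniqueFactorizationMonoid.squarefree_iff_nodup_normalizedFactors
      hS0).1 hS)]
  intro g hg
  rw [UniqueFactorizationMonoid.mem_normalizedFactors_iff' hS0] at hg
  rw [UniqueFactorizationMonoid.mem_normalizedFactors_iff' hP]
  exact ⟨hg.1, hg.2.1, h g hg.1 hg.2.2⟩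

section DihedralLift

variable {B : Type*} [Monoid B] {n : ℕ} [NeZero n] {A b : B}

theorem pow_zmod_val_add (hA : A ^ n = 1) (i j : ZMod n) :
    A ^ (i + j).val = A ^ i.val * A ^ j.val := by
  rw [ZMod.val_add, ← pow_add]
  exact (pow_eq_pow_mod _ hA).symm

theorem pow_mul_mul_pow (hAb : A * b * A = b) (m : ℕ) : A ^ m * b * A ^ m = b := by
  induction m with
  | zero => simp
  | succ m ih =>
    rw [pow_succ, show A ^ m * A * b * (A ^ m * A) = A ^ m * A * b * (A * A ^ m) by
      rw [← pow_succ, ← pow_succ'],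
      show A ^ m * A * b * (A * A ^ m) = A ^ m * (A * b * A) * A ^ m by
      simp only [mul_assoc], hAb, ih]

/-- Splitting off `A ^ i` from `A ^ j` lets `A ^ i b A ^ i` collapse to `b`. -/
theorem pow_val_mul_mul_pow_val (hA : A ^ n = 1) (hAb : A * b * A = b) (i j : ZMod n) :
    A ^ i.val * (b * A ^ j.val) = b * A ^ (j - i).val := by
  conv_lhs => rw [show j = i + (j - i) by ring, pow_zmod_val_add hA]
  rw [← mul_assoc, ← mul_assoc, pow_mul_mul_pow hAb]

/-- The homomorphism from the dihedral group determined by the images of the generators. -/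
def dihedralLift (hA : A ^ n = 1) (hb : b * b = 1) (hAb : A * b * A = b) :
    DihedralGroup n →* B where
  toFun
    | .r i => A ^ i.val
    | .sr i => b * A ^ i.val
  map_one' := by
    change A ^ (0 : ZMod n).val = 1
    rw [ZMod.val_zero, pow_zero]
  map_mul' x y := by
    cases x with
    | r i =>
      cases y with
      | r j => exact pow_zmod_val_add hA i j
      | sr j => exact (pow_val_mul_mul_pow_val hA hAb i j).symm
    | sr i =>
      cases y with
      | r j =>
        change b * A ^ (i + j).val = b * A ^ i.val * A ^ j.val
        rw [pow_zmod_val_add hA, mul_assoc]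
      | sr j =>
        change A ^ (j - i).val = b * A ^ i.val * (b * A ^ j.val)
        rw [mul_assoc, pow_val_mul_mul_pow_val hA hAb, ← mul_assoc, hb, one_mul]

theorem dihedralLift_r (hA : A ^ n = 1) (hb : b * b = 1) (hAb : A * b * A = b) (i : ZMod n) :
    dihedralLift hA hb hAb (.r i) = A ^ i.val := rfl

theorem dihedralLift_sr (hA : A ^ n = 1) (hb : b * b = 1) (hAb : A * b * A = b) (i : ZMod n) :
    dihedralLift hA hb hAb (.sr i) = b * A ^ i.val := rfl

theorem dihedralLift_r_one (hA : A ^ n = 1) (hb : b * b = 1) (hAb : A * b * A = b) :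
    dihedralLift hA hb hAb (.r 1) = A := by
  rw [dihedralLift_r, ZMod.val_one_eq_one_mod, ← pow_eq_pow_mod _ hA, pow_one]

theorem dihedralLift_sr_zero (hA : A ^ n = 1) (hb : b * b = 1) (hAb : A * b * A = b) :
    dihedralLift hA hb hAb (.sr 0) = b := by
  rw [dihedralLift_sr, ZMod.val_zero, pow_zero, mul_one]

end DihedralLift

/-! ### The group algebra as pairs of polynomials -/

section GroupAlgebra

variable {K : Type*} [Field K]

/-- The polynomial `∑ c i X ^ i` attached to a family of coefficients indexed by `ZMod n`. -/
def cyclicPoly {n : ℕ} [NeZero n] (c : ZMod n → K) : K[X] :=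
  ∑ i : ZMod n, monomial i.val (c i)

theorem eq_zero_of_dvd_cyclicPoly {n : ℕ} [NeZero n] {c : ZMod n → K}
    (h : X ^ n - 1 ∣ cyclicPoly c) (i : ZMod n) : c i = 0 := by
  have hn : n ≠ 0 := NeZero.ne n
  have hlt : cyclicPoly c ∈ degreeLT K n := by
    refine Submodule.sum_mem _ fun i _ => ?_
    rw [mem_degreeLT]
    exact (degree_monomial_le _ _).trans_lt (by exact_mod_cast ZMod.val_lt i)
  have h0 : cyclicPoly c = 0 := by
    refine eq_zero_of_dvd_of_degree_lt h ?_
    rw [← C_1, degree_X_pow_sub_C (Nat.pos_of_ne_zero hn)]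
    exact mem_degreeLT.1 hlt
  have h1 := congrArg (fun p => p.coeff i.val) h0
  simpa [cyclicPoly, finsetSum_coeff, coeff_monomial, (ZMod.val_injective n).eq_iff] using h1

theorem conjAlg_single {G : Type*} {q : ℕ} (h0 : (0 : K) ^ q = 0) (g : G) (c : K) :
    conjAlg q (MonoidAlgebra.single g c) = MonoidAlgebra.single g (c ^ q) := by
  rw [conjAlg, MonoidAlgebra.coeff_single, Finsupp.sum_single_index]
  rw [h0, MonoidAlgebra.single_zero]

theorem conjAlg_add {G : Type*} {q : ℕ} (hq : IsCharPow K q) (u v : MonoidAlgebra K G) :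
    conjAlg q (u + v) = conjAlg q u + conjAlg q v := by
  have h0 := map_zero (powHom hq 1)
  have h1 := map_add (powHom hq 1)
  simp only [powHom_apply, pow_one] at h0 h1
  rw [conjAlg, MonoidAlgebra.coeff_add, Finsupp.sum_add_index']
  · rfl
  · intro a
    rw [h0, MonoidAlgebra.single_zero]
  · intro a x y
    rw [h1, MonoidAlgebra.single_add]

/-- Since `sr i = b a ^ i`, the coefficients on rotations and on reflections form the two
polynomials `P` and `Q`. -/
theorem lift_dihedralLift {B : Type*} [Ring B] [Algebra K B] {n : ℕ} [NeZero n] {A b : B}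
    (hA : A ^ n = 1) (hb : b * b = 1) (hAb : A * b * A = b)
    (u : MonoidAlgebra K (DihedralGroup n)) :
    MonoidAlgebra.lift K B _ (dihedralLift hA hb hAb) u =
      aeval A (cyclicPoly fun i => u.coeff (.r i)) +
        b * aeval A (cyclicPoly fun i => u.coeff (.sr i)) := by
  rw [MonoidAlgebra.lift_apply, Finsupp.sum_fintype _ _ (fun _ => by rw [zero_smul]),
    ← DihedralGroup.equivSum.symm.sum_comp, Fintype.sum_sum_type, cyclicPoly, cyclicPoly,
    map_sum, map_sum, Finset.mul_sum]
  congr 1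
  · refine Finset.sum_congr rfl fun i _ => ?_
    rw [aeval_monomial, ← Algebra.smul_def]
    rfl
  · refine Finset.sum_congr rfl fun i _ => ?_
    rw [aeval_monomial, ← Algebra.smul_def, mul_smul_comm]
    rfl

theorem finrank_monoidAlgebra_dihedral (n : ℕ) [NeZero n] :
    Module.Finite K (MonoidAlgebra K (DihedralGroup n)) ∧
      Module.finrank K (MonoidAlgebra K (DihedralGroup n)) = 2 * n := by
  let e : MonoidAlgebra K (DihedralGroup n) ≃ₗ[K] DihedralGroup n →₀ K :=
    MonoidAlgebra.coeffLinearEquiv K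
  refine ⟨Module.Finite.equiv e.symm, ?_⟩
  rw [e.finrank_eq, Module.finrank_finsupp_self, DihedralGroup.card]

/-- A block representation gives a homomorphism from the group algebra. -/
theorem IsBlockRep.exists_algHom {B : Type*} [Ring B] [Algebra K B] {q n : ℕ} [NeZero n]
    (hq : IsCharPow K q) {S : Subalgebra K B} {A b : B} {ψ : B → B} {G : K[X]}
    (h : IsBlockRep q n S A b ψ G) :
    ∃ ρ : MonoidAlgebra K (DihedralGroup n) →ₐ[K] S,
      (ρ (MonoidAlgebra.of K _ (.r 1)) : B) = A ∧ (ρ (MonoidAlgebra.of K _ (.sr 0)) : B) = b ∧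
      (∀ u, (ρ u : B) = aeval A (cyclicPoly fun i => u.coeff (.r i)) +
        b * aeval A (cyclicPoly fun i => u.coeff (.sr i))) ∧
      ∀ u, (ρ (conjAlg q u) : B) = ψ (ρ u) := by
  let A' : S := ⟨A, h.memA⟩
  let b' : S := ⟨b, h.memb⟩
  have hA : A' ^ n = 1 := Subtype.ext h.pow_eq
  have hb : b' * b' = 1 := Subtype.ext h.mul_self
  have hAb : A' * b' * A' = b' := Subtype.ext h.mul_mul
  refine ⟨MonoidAlgebra.lift K S _ (dihedralLift hA hb hAb), ?_, ?_, fun u => ?_, fun u => ?_⟩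
  · rw [MonoidAlgebra.lift_of, dihedralLift_r_one]
  · rw [MonoidAlgebra.lift_of, dihedralLift_sr_zero]
  · have he : ∀ P : K[X], (aeval A' P : B) = aeval A P := fun P =>
      (aeval_algHom_apply S.val A' P).symm
    rw [lift_dihedralLift, Subalgebra.coe_add, Subalgebra.coe_mul, he, he]
  · obtain ⟨Ψ, hΨ, hΨA, hΨb, hΨc⟩ := h.hom
    have h0 := map_zero (powHom hq 1)
    rw [powHom_apply, pow_one] at h0
    rw [← hΨ]
    -- Both sides are additive in `u`, so only multiples of group elements matter; there the
    -- semilinearity of `Ψ` and its fixing `A` and `b` suffice.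
    induction u using MonoidAlgebra.induction_linear with
    | zero =>
      have : conjAlg q (0 : MonoidAlgebra K (DihedralGroup n)) = 0 := by
        rw [conjAlg, MonoidAlgebra.coeff_zero, Finsupp.sum_zero_index]
      rw [this, map_zero, Subalgebra.coe_zero, map_zero]
    | add u v hu hv =>
      rw [conjAlg_add hq, map_add, map_add, Subalgebra.coe_add, Subalgebra.coe_add, map_add, hu, hv]
    | single g c =>
      rw [conjAlg_single h0, MonoidAlgebra.lift_single, MonoidAlgebra.lift_single,
        Subalgebra.coe_smul, Subalgebra.coe_smul, Algebra.smul_def, Algebra.smul_def, map_mul, hΨc]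
      congr 1
      cases g with
      | r i =>
        rw [dihedralLift_r, Subalgebra.coe_pow, map_pow, hΨA]
      | sr i =>
        rw [dihedralLift_sr, Subalgebra.coe_mul, Subalgebra.coe_pow, map_mul, map_pow, hΨA, hΨb]

end GroupAlgebra

theorem dvd_orbitProd {K : Type*} [Field K] (q : ℕ) (f : K[X]) : f ∣ orbitProd q f := by
  unfold orbitProd
  cases kind q f with
  | J0odd => exact dvd_rfl
  | J0two => exact dvd_rfl
  | J1 => exact dvd_mul_right _ _
  | J2 => exact dvd_mul_right _ _
  | J3 => exact dvd_mul_right _ _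
  | J4 => exact ((dvd_mul_right _ _).mul_right _).mul_right _

theorem natCast_ne_zero_of_coprime {K : Type*} [Field K] [Finite K] {q n : ℕ}
    (hK : Nat.card K = q ^ 2) (hqn : Nat.Coprime q n) : (n : K) ≠ 0 := by
  obtain ⟨p, e, hp, hc, rfl⟩ := isCharPow_of_card hK
  rw [Ne, CharP.cast_eq_zero_iff K p]
  intro hd
  -- For `e = 0` the field would have a single element. So the characteristic divides `q` and cannot
  -- divide `n`.
  have he : e ≠ 0 := by
    rintro rfl
    have : 1 < Nat.card K := Finite.one_lt_card
    simp [hK] at this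
  exact hp.one_lt.ne' (Nat.eq_one_of_dvd_coprimes hqn (dvd_pow_self p he) hd)

end

end DihedralConj

/-! ### Assembling the isomorphism -/

open DihedralConj in
theorem theorem3p5 {K : Type*} [Field K] [Finite K] (q n : ℕ) (hK : Nat.card K = q ^ 2)
    (hqn : Nat.Coprime q n) {J : Type*} [Fintype J] (f : J → Polynomial K)
    (hf : IsDecomposition q n f) {Ω : Type*} [Field Ω] [Algebra K Ω] (α : J → Ω)
    (hα : ∀ j, Polynomial.aeval (α j) (f j) = 0) :
    ∃ ρ : MonoidAlgebra K (DihedralGroup n) ≃ₐ[K]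
        ((j : J) → block K q (α j) (kind q (f j))),
      (∀ j, (ρ (MonoidAlgebra.of K _ (DihedralGroup.r 1)) j : Amb Ω (kind q (f j))) =
          rhoA q (f j) (α j) (kind q (f j)) ∧
        (ρ (MonoidAlgebra.of K _ (DihedralGroup.sr 0)) j : Amb Ω (kind q (f j))) =
          rhoB q (α j) (kind q (f j))) ∧
      ∃ φ : (j : J) → block K q (α j) (kind q (f j)) → block K q (α j) (kind q (f j)),
        (∀ j x, (φ j x : Amb Ω (kind q (f j))) =
          phi q (f j).natDegree (α j) (kind q (f j)) x) ∧
        ∀ u : MonoidAlgebra K (DihedralGroup n), ρ (conjAlg q u) = fun j => φ j (ρ u j) := by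

  classical
  have hq := isCharPow_of_card hK
  have hn := natCast_ne_zero_of_coprime hK hqn
  -- Positivity of `n` follows from coprimality, as `n` is nonzero already in `K`.
  have : NeZero n := ⟨fun h => hn (by rw [h, Nat.cast_zero])⟩
  have hn0 : n ≠ 0 := NeZero.ne n
  have hdvd : ∀ j, orbitProd q (f j) ∣ (X : K[X]) ^ n - 1 := fun j =>
    hf.prod_eq ▸ Finset.dvd_prod_of_mem _ (Finset.mem_univ j)
  have hfd : ∀ j, f j ∣ (X : K[X]) ^ n - 1 := fun j => (dvd_orbitProd q (f j)).trans (hdvd j)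
  have hαn : ∀ j, α j ^ n = 1 := by
    intro j
    obtain ⟨g, hg⟩ := hfd j
    have := congrArg (aeval (α j)) hg
    simpa [hα j, sub_eq_zero] using this
  have hα0 : ∀ j, α j ≠ 0 := fun j h0 => by
    have := hαn j
    rw [h0, zero_pow hn0] at this
    exact zero_ne_one this
  have hc : ∀ j, (f j).coeff 0 ≠ 0 := fun j h0 => by
    have := (X_dvd_iff.2 h0).trans (hfd j)
    rw [X_dvd_iff] at this
    simp [coeff_X_pow, hn0.symm] at this
  have hrep := fun j => isBlockRep_block (n := n) hK (hf.monic j) (hf.irreducible j) (hα0 j) (hc j)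
    (hα j) (hαn j) (kind q (f j)) rfl
  choose ρ hρa hρb hρu hρc using fun j => (hrep j).exists_algHom hq
  let R : MonoidAlgebra K (DihedralGroup n) →ₐ[K] ((j : J) → block K q (α j) (kind q (f j))) :=
    AlgHom.pi ρ
  have hsq : Squarefree ((X : K[X]) ^ n - 1) := (X_pow_sub_one_separable_iff.2 hn).squarefree
  have hinj : Function.Injective R := by
    rw [injective_iff_map_eq_zero]
    intro u hu
    have hj : ∀ j, ∀ g : K[X], Irreducible g → g ∣ orbitProd q (f j) →
        g ∣ cyclicPoly (fun i => u.coeff (.r i)) ∧ g ∣ cyclicPoly (fun i => u.coeff (.sr i)) := by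
      intro j
      apply (hrep j).dvd
      rw [← hρu j, show ρ j u = 0 from congrFun hu j, Subalgebra.coe_zero]
    have hg : ∀ g : K[X], Irreducible g → g ∣ X ^ n - 1 →
        g ∣ cyclicPoly (fun i => u.coeff (.r i)) ∧ g ∣ cyclicPoly (fun i => u.coeff (.sr i)) := by
      intro g hg hd
      rw [hf.prod_eq, hg.prime.dvd_finsetProd_iff] at hd
      obtain ⟨j, -, hd⟩ := hd
      exact hj j g hg hd
    ext x
    cases x with
    | r i =>
      exact eq_zero_of_dvd_cyclicPoly (dvd_of_squarefree hsq fun g h1 h2 => (hg g h1 h2).1) i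
    | sr i =>
      exact eq_zero_of_dvd_cyclicPoly (dvd_of_squarefree hsq fun g h1 h2 => (hg g h1 h2).2) i
  obtain ⟨hfin, hrank⟩ := finrank_monoidAlgebra_dihedral (K := K) n
  have hfin' : ∀ j, Module.Finite K (block K q (α j) (kind q (f j))) := fun j => (hrep j).finite
  have hle : Module.finrank K ((j : J) → block K q (α j) (kind q (f j))) ≤ 2 * n := by
    rw [Module.finrank_pi_fintype]
    refine (Finset.sum_le_sum fun j _ => (hrep j).finrank_le).trans ?_
    have hd := congrArg natDegree hf.prod_eq
    rw [← C_1, natDegree_X_pow_sub_C, natDegree_prod] at hd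
    · rw [← Finset.mul_sum, ← hd]
    · intro j _ h0
      exact hsq.ne_zero (zero_dvd_iff.1 (h0 ▸ hdvd j))
  -- Injectivity gives the reverse of the dimension bound, so the dimensions agree.
  have hsurj : Function.Surjective R := by
    have h1 := LinearMap.finrank_le_finrank_of_injective (f := R.toLinearMap) hinj
    exact (LinearMap.injective_iff_surjective_of_finrank_eq_finrank (f := R.toLinearMap)
      (le_antisymm h1 (hrank ▸ hle))).1 hinj
  -- Every `x` in the block is some `ρ_j(u)`, and its image under the formula is `ρ_j` of the
  -- conjugate of `u`, which lies in the block.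
  have hmem : ∀ j (x : block K q (α j) (kind q (f j))),
      phi q (f j).natDegree (α j) (kind q (f j)) x ∈ block K q (α j) (kind q (f j)) := by
    intro j x
    obtain ⟨u, hu⟩ := hsurj (Pi.single j x)
    have hx : ρ j u = x := (congrFun hu j).trans (by rw [Pi.single_eq_same])
    rw [← hx, ← hρc j u]
    exact Subtype.property _
  refine ⟨AlgEquiv.ofBijective R ⟨hinj, hsurj⟩, fun j => ⟨hρa j, hρb j⟩,
    fun j x => ⟨_, hmem j x⟩, fun j x => rfl, fun u => funext fun j => Subtype.ext (hρc j u)⟩
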